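/- Let $p,q\ge 0$ be integers and let $\mathfrak g=\mathfrak{gl}(2p|2q)$ over $\mathbb C$, realised by matrices acting on $\mathbb C^{2p|2q}$. Let $\mathfrak t$ be the diagonal Cartan subalgebra, and write $\epsilon_1^+,\dots,\epsilon_p^+,\epsilon_1^-,\dots,\epsilon_p^-\,|\,\delta_1^+,\dots,\delta_q^+,\delta_1^-,\dots,\delta_q^-$ for the coordinate functions on $\mathfrak t$, from top left to bottom right. Let $\mathfrak b_\natural^-\supseteq\mathfrak t$ be the Borel subalgebra whose simple roots are the differences $X_k-X_{k+1}$ of consecutive terms of the chain $$[\epsilon_1^-\cdots\epsilon_p^-\,|\,\delta_1^-\cdots\delta_q^-\,\delta_q^+\cdots\delta_1^+\,|\,\epsilon_p^+\cdots\epsilon_1^+].$$ For a partition $\lambda=(\lambda_1\ge\lambda_2\ge\cdots)$ with transpose $\lambda'$, put $$-\lambda^\natural:=-\sum_{i=1}^p\lambda_i(\epsilon_i^+-\epsilon_i^-)-\sum_{j=1}^q\max(\lambda_j'-p,0)\,(\delta_j^+-\delta_j^-)\in\mathfrak t^*.$$ Modules are $\mathbb Z/2$-graded, and irreducible means nonzero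 with no graded submodules other than $0$ and the whole module. **Theorem.** Let $\lambda$ be a $(p,q)$-hook partition, that is, $\lambda_{p+1}\le q$. Then there exists an irreducible $\mathfrak g$-module $V_\lambda=V(-\lambda^\natural,\mathfrak b_\natural^-)$ of highest weight $-\lambda^\natural$ with respect to $\mathfrak b_\natural^-$, and every such module is finite dimensional. -/

import Mathlib

namespace GLSuper

/-- The coordinates of `ℂ^{2p|2q}`: the even ones `ε⁺ᵢ`, `ε⁻ᵢ` (`i = 1, …, p`), followed by the odd
ones `δ⁺ⱼ`, `δ⁻ⱼ` (`j = 1, …, q`), all numbered from `0`. -/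
abbrev Idx (p q : ℕ) : Type := (Fin p ⊕ Fin p) ⊕ (Fin q ⊕ Fin q)

variable {p q : ℕ}

/-- The index of `ε⁺ᵢ`. -/
abbrev epsPlus (i : Fin p) : Idx p q := Sum.inl (Sum.inl i)

/-- The index of `ε⁻ᵢ`. -/
abbrev epsMinus (i : Fin p) : Idx p q := Sum.inl (Sum.inr i)

/-- The index of `δ⁺ⱼ`. -/
abbrev deltaPlus (j : Fin q) : Idx p q := Sum.inr (Sum.inl j)

/-- The index of `δ⁻ⱼ`. -/
abbrev deltaMinus (j : Fin q) : Idx p q := Sum.inr (Sum.inr j)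

/-- The parity of a coordinate of `ℂ^{2p|2q}`. -/
def parity : Idx p q → ZMod 2
  | Sum.inl _ => 0
  | Sum.inr _ => 1

/-- The underlying vector space of the Lie superalgebra `gl(2p|2q)` over `ℂ`. -/
abbrev GlMatrix (p q : ℕ) : Type := Matrix (Idx p q) (Idx p q) ℂ

/-- The homogeneous component of `gl(2p|2q)` of parity `d`: block diagonal matrices for `d = 0`,
block off-diagonal matrices for `d = 1`. -/
def homogeneous (p q : ℕ) (d : ZMod 2) : Submodule ℂ (GlMatrix p q) where
  carrier := {A | ∀ i j, parity i + parity j ≠ d → A i j = 0}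
  add_mem' hA hB i j h := by simp [hA i j h, hB i j h]
  zero_mem' _ _ _ := rfl
  smul_mem' c A hA i j h := by simp [hA i j h]

/-- The Koszul sign `(-1)^{ab}`. -/
def sign (a b : ZMod 2) : ℂ := (-1) ^ (a.val * b.val)

/-- The bracket `[A, B] = AB - (-1)^{ab} BA` of `gl(2p|2q)` for homogeneous elements `A`, `B` of
parities `a`, `b`. -/
def superBracket (a b : ZMod 2) (A B : GlMatrix p q) : GlMatrix p q := A * B - sign a b • (B * A)

/-- A `gl(2p|2q)`-module structure on a complex vector space `V`: a `ℤ/2`-grading of `V`, and a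
linear map `gl(2p|2q) → End V` that preserves parity and takes the superbracket to the
supercommutator. -/
structure SuperModule (p q : ℕ) (V : Type*) [AddCommGroup V] [Module ℂ V] where
  /-- the even part `V₀` and the odd part `V₁` -/
  grading : ZMod 2 → Submodule ℂ V
  isInternal : DirectSum.IsInternal grading
  /-- the action -/
  act : GlMatrix p q →ₗ[ℂ] Module.End ℂ V
  act_mem : ∀ (a b : ZMod 2) (A : GlMatrix p q) (v : V),
    A ∈ homogeneous p q a → v ∈ grading b → act A v ∈ grading (a + b)
  act_superBracket : ∀ (a b : ZMod 2) (A B : GlMatrix p q),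
    A ∈ homogeneous p q a → B ∈ homogeneous p q b →
      act (superBracket a b A B) = act A * act B - sign a b • (act B * act A)

namespace SuperModule

variable {V : Type*} [AddCommGroup V] [Module ℂ V]

/-- `W` is a submodule in the super sense: a graded subspace stable under the action. -/
def IsSubmodule (M : SuperModule p q V) (W : Submodule ℂ V) : Prop :=
  W ≤ ⨆ d, W ⊓ M.grading d ∧ ∀ (A : GlMatrix p q), ∀ v ∈ W, M.act A v ∈ W

/-- The module is irreducible: it is nonzero, and its only submodules are `0` and itself. -/
def IsIrreducible (M : SuperModule p q V) : Prop :=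
  Nontrivial V ∧ ∀ W : Submodule ℂ V, M.IsSubmodule W → W = ⊥ ∨ W = ⊤

/-- `v` is a highest weight vector of weight `μ` for the subalgebra `b`, which is meant to be a Borel
subalgebra containing the diagonal matrices: `v ≠ 0`, diagonal matrices `H ∈ b` act on `v` by the
scalar `μ(H) = ∑ μᵢ Hᵢᵢ`, and strictly triangular elements of `b` kill `v`. A weight is given by its
coefficients in the basis of coordinate functions `ε^±ᵢ`, `δ^±ⱼ` of diagonal matrices. -/
def IsHighestWeightVector (M : SuperModule p q V) (b : Submodule ℂ (GlMatrix p q)) (μ : Idx p q → ℂ)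
    (v : V) : Prop :=
  v ≠ 0 ∧ ∀ A ∈ b, M.act A v = (∑ i, μ i * A i i) • v

/-- The module is an irreducible module of `b`-highest weight `μ`, i.e. it is `V(μ, b)`. -/
def IsIrreducibleOfHighestWeight (M : SuperModule p q V) (b : Submodule ℂ (GlMatrix p q))
    (μ : Idx p q → ℂ) : Prop :=
  M.IsIrreducible ∧ ∃ v, M.IsHighestWeightVector b μ v

end SuperModule

/-- The position of a coordinate in the chain
`[ε⁻₁ ⋯ ε⁻ₚ | δ⁻₁ ⋯ δ⁻_q δ⁺_q ⋯ δ⁺₁ | ε⁺ₚ ⋯ ε⁺₁]`. -/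
def position : Idx p q → ℕ
  | Sum.inl (Sum.inr i) => i
  | Sum.inr (Sum.inr j) => p + j
  | Sum.inr (Sum.inl j) => p + q + j.rev
  | Sum.inl (Sum.inl i) => p + q + q + i.rev

/-- The Borel subalgebra `b_♮⁻` of `gl(2p|2q)`, whose simple roots are the differences of
consecutive terms of the chain. It is spanned by the matrix units `E_{ij}` such that `i` does not
come after `j` in the chain; `E_{ij}` is a root vector for the difference of the `i`-th and the
`j`-th coordinate function. -/
def borelNaturalMinus (p q : ℕ) : Submodule ℂ (GlMatrix p q) where
  carrier := {A | ∀ i j, position j < position i → A i j = 0}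
  add_mem' hA hB i j h := by simp [hA i j h, hB i j h]
  zero_mem' _ _ _ := rfl
  smul_mem' c A hA i j h := by simp [hA i j h]

/-- `(p, q)`-hook partitions: `λ_{p+1} ≤ q` (rows are numbered from `0`). -/
def IsHookPartition (p q : ℕ) (lam : YoungDiagram) : Prop := lam.rowLen p ≤ q

/-- The weight
`-λ^♮ = -∑ᵢ λᵢ (ε⁺ᵢ - ε⁻ᵢ) - ∑ⱼ max(λ'ⱼ - p, 0) (δ⁺ⱼ - δ⁻ⱼ)`.
The subtraction of natural numbers `lam.colLen j - p` is truncated, as intended. -/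
def negNaturalWeight (p q : ℕ) (lam : YoungDiagram) : Idx p q → ℂ
  | Sum.inl (Sum.inl i) => -(lam.rowLen i : ℂ)
  | Sum.inl (Sum.inr i) => (lam.rowLen i : ℂ)
  | Sum.inr (Sum.inl j) => -((lam.colLen j - p : ℕ) : ℂ)
  | Sum.inr (Sum.inr j) => ((lam.colLen j - p : ℕ) : ℂ)

end GLSuper

/-! ### Koszul signs, and representations given by a parity involution and matrix units. -/

namespace GLSuper
open scoped TensorProduct

variable {p q : ℕ}

/-! It suffices to find some representation with a vector of weight $-\lambda^\natural$, killed by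
the positive root vectors, inside a finite dimensional stable subspace.

Existence of an irreducible module follows from any such vector $v$
(`ParityRep.exists_irreducible`): divide by a stable subspace that is maximal among those avoiding
$v$. Every nonzero stable subspace of the quotient then contains the image of $v$, so this image
generates an irreducible module.

Finiteness (`ParityRep.finiteDimensional_of_irreducible`) is a graph argument. Let $V$ be
irreducible with highest weight vector $v$, and let $w\in G$ be the given vector in the finite
dimensional stable subspace. Let $U\subseteq V\oplus G$ be generated by $(v,w)$. Its highest weight
space is the line through $(v,w)$, so $U$ does not contain $(v,0)$. By irreducibility $U\cap V=0$
and $U$ projects onto $V$. Hence $U$ embeds in $G$, and $V$ is a quotient of $U$.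

The vector comes from an oscillator representation, in the spirit of Howe duality. Take $s$ columns
of each of two kinds, with fermions for the even coordinates and bosons for the odd ones, and let
$E_{IJ}$ act by $\sum\alpha_I\beta_J$. In columns of the second kind creation and annihilation are
exchanged, so that these columns carry a dual action; the resulting constant is removed by a
multiple of the supertrace. Each $E_{IJ}$ creates one particle and annihilates one, so the span of
states with at most $n$ particles is stable and finite dimensional.

The vector (`exists_fock_vector`) fills fermion modes according to the first $p$ rows of $\lambda$
and multiplies by a product of minors in the bosons that encodes the rest of $\lambda$. Minus
coordinates use only columns of the first kind and plus coordinates only those of the second. -/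

theorem zmod_two_cases : ∀ a : ZMod 2, a = 0 ∨ a = 1 := by decide

theorem univ_zmod_two : (Set.univ : Set (ZMod 2)) = {0, 1} :=
  Set.ext fun x => by simpa using zmod_two_cases x

theorem sign_zero_left (a : ZMod 2) : sign 0 a = 1 := by simp [sign]

theorem sign_zero_right (a : ZMod 2) : sign a 0 = 1 := by simp [sign]

theorem sign_one_one : sign 1 1 = -1 := by simp [sign, ZMod.val_one]

theorem sign_add_left (a b c : ZMod 2) : sign (a + b) c = sign a c * sign b c := by
  have h : (1 + 1 : ZMod 2) = 0 := rfl
  rcases zmod_two_cases a with rfl | rfl <;> rcases zmod_two_cases b with rfl | rfl <;>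
    rcases zmod_two_cases c with rfl | rfl <;>
    simp [sign_zero_left, sign_zero_right, sign_one_one, h]

theorem sign_comm (a b : ZMod 2) : sign a b = sign b a := by
  simp [sign, mul_comm]

theorem sign_add_right (a b c : ZMod 2) : sign a (b + c) = sign a b * sign a c := by
  rw [sign_comm, sign_add_left, sign_comm b, sign_comm c]

theorem sign_mul_self (a b : ZMod 2) : sign a b * sign a b = 1 := by
  simp [sign, ← mul_pow]

theorem sign_add_self (a b : ZMod 2) : sign (a + a) b = 1 := by
  rw [sign_add_left, sign_mul_self]

theorem eq_zero_of_eq_neg {V : Type*} [AddCommGroup V] [Module ℂ V] {v : V} (h : v = -v) :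
    v = 0 := by
  have h2 : (2 : ℂ) • v = 0 := by
    rw [two_smul]
    nth_rw 2 [h]
    exact add_neg_cancel v
  exact (smul_eq_zero.1 h2).resolve_left two_ne_zero

/-- A representation of `gl(2p|2q)` on a super vector space, in terms of the parity involution and
the matrix units. -/
structure ParityRep (p q : ℕ) (V : Type*) [AddCommGroup V] [Module ℂ V] where
  /-- the parity involution -/
  P : Module.End ℂ V
  /-- the action of the matrix units -/
  e : Idx p q → Idx p q → Module.End ℂ V
  P_P : ∀ v, P (P v) = v
  P_e : ∀ I J v, P (e I J v) = sign (parity I + parity J) 1 • e I J (P v)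
  e_e : ∀ I J K L v, e I J (e K L v) =
    sign (parity I + parity J) (parity K + parity L) • e K L (e I J v) +
      ((if J = K then e I L v else 0) - sign (parity I + parity J) (parity K + parity L) •
        (if L = I then e K J v else 0))

namespace ParityRep

variable {V N : Type*} [AddCommGroup V] [Module ℂ V] [AddCommGroup N] [Module ℂ N]

/-- Graded subspaces stable under the action. -/
def Stable (ρ : ParityRep p q V) (W : Submodule ℂ V) : Prop :=
  (∀ v ∈ W, ρ.P v ∈ W) ∧ ∀ I J, ∀ v ∈ W, ρ.e I J v ∈ W

/-- Highest weight vectors for the Borel subalgebra `b_♮⁻`. -/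
def IsHW (ρ : ParityRep p q V) (μ : Idx p q → ℂ) (v : V) : Prop :=
  (∀ I, ρ.e I I v = μ I • v) ∧ ∀ I J, position I < position J → ρ.e I J v = 0

theorem IsHW.P {ρ : ParityRep p q V} {μ : Idx p q → ℂ} {v : V} (h : ρ.IsHW μ v) :
    ρ.IsHW μ (ρ.P v) := by
  have key : ∀ I J, ρ.e I J (ρ.P v) = sign (parity I + parity J) 1 • ρ.P (ρ.e I J v) := by
    intro I J
    rw [ρ.P_e, smul_smul, sign_mul_self, one_smul]
  refine ⟨fun I => ?_, fun I J hIJ => ?_⟩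
  · rw [key, h.1, sign_add_self, one_smul, map_smul]
  · rw [key, h.2 I J hIJ, map_zero, smul_zero]

theorem IsHW.add {ρ : ParityRep p q V} {μ : Idx p q → ℂ} {v w : V} (h : ρ.IsHW μ v)
    (h' : ρ.IsHW μ w) : ρ.IsHW μ (v + w) :=
  ⟨fun I => by rw [map_add, h.1, h'.1, smul_add], fun I J hIJ => by
    rw [map_add, h.2 I J hIJ, h'.2 I J hIJ, add_zero]⟩

theorem IsHW.smul {ρ : ParityRep p q V} {μ : Idx p q → ℂ} {v : V} (c : ℂ) (h : ρ.IsHW μ v) :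
    ρ.IsHW μ (c • v) :=
  ⟨fun I => by rw [map_smul, h.1, smul_comm], fun I J hIJ => by
    rw [map_smul, h.2 I J hIJ, smul_zero]⟩

/-- A highest weight vector can be taken homogeneous. -/
theorem exists_homogeneous_hw {ρ : ParityRep p q V} {μ : Idx p q → ℂ} {v : V} (h : ρ.IsHW μ v)
    {W : Submodule ℂ V} (hW : ρ.Stable W) (hv : v ∈ W) (h0 : v ≠ 0) :
    ∃ w ∈ W, ∃ c : ℂ, c * c = 1 ∧ w ≠ 0 ∧ ρ.IsHW μ w ∧ ρ.P w = c • w := by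
  -- Either the even projection of `v` is nonzero, or `v` is itself odd.
  by_cases hs : v + ρ.P v = 0
  · refine ⟨v, hv, -1, by norm_num, h0, h, ?_⟩
    rw [neg_smul, one_smul, eq_neg_iff_add_eq_zero, add_comm, hs]
  · refine ⟨v + ρ.P v, W.add_mem hv (hW.1 v hv), 1, by norm_num, hs, h.add h.P, ?_⟩
    rw [map_add, ρ.P_P, one_smul, add_comm]

/-- Change of parity. -/
def twist (ρ : ParityRep p q V) (c : ℂ) (hc : c * c = 1) : ParityRep p q V where
  P := c • ρ.P
  e := ρ.e
  P_P v := by simp [smul_smul, hc, ρ.P_P]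
  P_e I J v := by simp [ρ.P_e, smul_comm c]
  e_e := ρ.e_e

/-- The direct sum of two representations. -/
def prod (ρ : ParityRep p q V) (τ : ParityRep p q N) : ParityRep p q (V × N) where
  P := ρ.P.prodMap τ.P
  e I J := (ρ.e I J).prodMap (τ.e I J)
  P_P v := by simp [ρ.P_P, τ.P_P]
  P_e I J v := by simp [ρ.P_e, τ.P_e]
  e_e I J K L v := by
    ext
    · simp only [LinearMap.prodMap_apply, Prod.fst_add, Prod.smul_fst, Prod.fst_sub]
      rw [ρ.e_e]; split_ifs <;> simp
    · simp only [LinearMap.prodMap_apply, Prod.snd_add, Prod.smul_snd, Prod.snd_sub]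
      rw [τ.e_e]; split_ifs <;> simp

/-- The restriction of a representation to a stable subspace. -/
def restrict (ρ : ParityRep p q V) (W : Submodule ℂ V) (hW : ρ.Stable W) : ParityRep p q W where
  P := ρ.P.restrict hW.1
  e I J := (ρ.e I J).restrict (hW.2 I J)
  P_P v := Subtype.ext (ρ.P_P v)
  P_e I J v := Subtype.ext (ρ.P_e I J v)
  e_e I J K L v := Subtype.ext <| (ρ.e_e I J K L v).trans <| by split_ifs <;> simp

/-- The quotient of a representation by a stable subspace. -/
def quotient (ρ : ParityRep p q V) (W : Submodule ℂ V) (hW : ρ.Stable W) :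
    ParityRep p q (V ⧸ W) where
  P := W.mapQ W ρ.P hW.1
  e I J := W.mapQ W (ρ.e I J) (hW.2 I J)
  P_P v := by
    induction v using Submodule.Quotient.induction_on with
    | _ v => simp [ρ.P_P]
  P_e I J v := by
    induction v using Submodule.Quotient.induction_on with
    | _ v => simp [ρ.P_e]
  e_e I J K L v := by
    induction v using Submodule.Quotient.induction_on with
    | _ v =>
      simp only [Submodule.mapQ_apply]
      rw [ρ.e_e]; split_ifs <;> simp

/-! ### The submodule generated by a highest weight vector -/

/-- The span of all vectors obtained from `x` by lowering operators. -/
inductive Lowered (ρ : ParityRep p q V) (x : V) : V → Prop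
  | base : Lowered ρ x x
  | zero : Lowered ρ x 0
  | add {y z : V} : Lowered ρ x y → Lowered ρ x z → Lowered ρ x (y + z)
  | smul (c : ℂ) {y : V} : Lowered ρ x y → Lowered ρ x (c • y)
  | lower (I J : Idx p q) {y : V} : position J < position I → Lowered ρ x y →
      Lowered ρ x (ρ.e I J y)

theorem position_injective : Function.Injective (position : Idx p q → ℕ) := by
  rintro ((i | i) | (i | i)) ((j | j) | (j | j)) h <;>
    simp only [position, Fin.val_rev, Sum.inl.injEq, Sum.inr.injEq, reduceCtorEq, Fin.ext_iff]
      at h ⊢ <;> omega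

/-- The submodule generated by a homogeneous highest weight vector. -/
def generated (ρ : ParityRep p q V) (x : V) : Submodule ℂ V where
  carrier := {y | Lowered ρ x y}
  add_mem' := Lowered.add
  zero_mem' := Lowered.zero
  smul_mem' c _ := Lowered.smul c

/-- Moving an operator past a lowering one leaves commutator terms with arbitrary indices, but these
act on a shorter word. Hence the induction is over all `I J` at once, and no ordered basis of
monomials is needed. -/
theorem generated_stable {ρ : ParityRep p q V} {μ : Idx p q → ℂ} {x : V} (h : ρ.IsHW μ x)
    {c : ℂ} (hP : ρ.P x = c • x) : ρ.Stable (ρ.generated x) := by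
  refine ⟨fun v hv => ?_, fun I J v hv => ?_⟩
  · change Lowered ρ x v at hv
    change Lowered ρ x _
    induction hv with
    | base => rw [hP]; exact .smul c .base
    | zero => rw [map_zero]; exact .zero
    | add _ _ h1 h2 => rw [map_add]; exact h1.add h2
    | smul c _ h1 => rw [map_smul]; exact h1.smul c
    | lower I J hIJ _ h1 => rw [ρ.P_e]; exact .smul _ (.lower I J hIJ h1)
  · change Lowered ρ x v at hv
    change Lowered ρ x _
    induction hv generalizing I J with
    | base =>
      rcases lt_trichotomy (position I) (position J) with hlt | heq | hgt
      · rw [h.2 I J hlt]; exact .zero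
      · rw [position_injective heq, h.1]; exact .smul _ .base
      · exact .lower I J hgt .base
    | zero => rw [map_zero]; exact .zero
    | add _ _ h1 h2 => rw [map_add]; exact (h1 I J).add (h2 I J)
    | smul c _ h1 => rw [map_smul]; exact (h1 I J).smul c
    | lower K L hKL _ h1 =>
      rw [ρ.e_e]
      refine .add (.smul _ (.lower K L hKL (h1 I J))) ((ρ.generated x).sub_mem ?_
        ((ρ.generated x).smul_mem _ ?_))
      · split_ifs
        · exact h1 I L
        · exact .zero
      · split_ifs
        · exact h1 K J
        · exact .zero

theorem self_mem_generated (ρ : ParityRep p q V) (x : V) : x ∈ ρ.generated x := Lowered.base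

theorem generated_le {ρ : ParityRep p q V} {x : V} {W : Submodule ℂ V} (hW : ρ.Stable W)
    (hx : x ∈ W) : ρ.generated x ≤ W := by
  intro v hv
  change Lowered ρ x v at hv
  induction hv with
  | base => exact hx
  | zero => exact W.zero_mem
  | add _ _ h1 h2 => exact W.add_mem h1 h2
  | smul c _ h1 => exact W.smul_mem c h1
  | lower I J _ _ h1 => exact hW.2 I J _ h1

/-- The principal grading element of the diagonal Cartan subalgebra. -/
def height (ρ : ParityRep p q V) : Module.End ℂ V := ∑ I, (position I : ℂ) • ρ.e I I

/-- Since `position` increases along the chain, lowering operators raise the eigenvalue of `height`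
by a positive integer. This separates `x` from everything strictly below it. -/
theorem height_e (ρ : ParityRep p q V) (I J : Idx p q) (v : V) :
    ρ.height (ρ.e I J v) =
      ρ.e I J (ρ.height v) + ((position I : ℂ) - position J) • ρ.e I J v := by
  have key : ∀ K, ρ.e K K (ρ.e I J v) = ρ.e I J (ρ.e K K v) +
      ((if K = I then ρ.e I J v else 0) - (if J = K then ρ.e I J v else 0)) := by
    intro K
    rw [ρ.e_e, sign_add_self, one_smul, one_smul]
    congr 2
    · split_ifs with h <;> simp [h]
    · split_ifs with h <;> simp [h]
  simp only [height, LinearMap.sum_apply, LinearMap.smul_apply, map_sum, map_smul, key, smul_add,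
    Finset.sum_add_distrib, smul_sub, Finset.sum_sub_distrib, sub_smul]
  simp

theorem IsHW.height {ρ : ParityRep p q V} {μ : Idx p q → ℂ} {v : V} (h : ρ.IsHW μ v) :
    ρ.height v = (∑ I, (position I : ℂ) * μ I) • v := by
  simp only [ParityRep.height, LinearMap.sum_apply, LinearMap.smul_apply, h.1, smul_smul,
    Finset.sum_smul]

/-- Up to multiples of `x`, all of `generated x` lies in eigenspaces of the principal grading
element other than that of `x`. -/
theorem generated_le_eigenspaces {ρ : ParityRep p q V} {μ : Idx p q → ℂ} {x : V}
    (h : ρ.IsHW μ x) :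
    ρ.generated x ≤ Submodule.span ℂ {x} ⊔
      ⨆ n : ℕ, ρ.height.eigenspace ((∑ I, (position I : ℂ) * μ I) + (n + 1)) := by
  set m := ∑ I, (position I : ℂ) * μ I with hm
  intro v hv
  change Lowered ρ x v at hv
  induction hv with
  | base => exact Submodule.mem_sup_left (Submodule.mem_span_singleton_self x)
  | zero => exact Submodule.zero_mem _
  | add _ _ h1 h2 => exact Submodule.add_mem _ h1 h2
  | smul c _ h1 => exact Submodule.smul_mem _ c h1
  | @lower I J y hIJ _ h1 =>
    refine Submodule.mem_sup_right ?_
    obtain ⟨d, hd⟩ := Nat.exists_eq_add_of_lt hIJ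
    have hd' : (position I : ℂ) - position J = d + 1 := by rw [hd]; push_cast; ring
    have step : ∀ (k : ℕ) (z : V), ρ.height z = (m + k) • z → ρ.e I J z ∈
        ⨆ n : ℕ, ρ.height.eigenspace (m + (n + 1)) := by
      intro k z hz
      refine Submodule.mem_iSup_of_mem (k + d) (Module.End.mem_eigenspace_iff.2 ?_)
      rw [height_e, hz, map_smul, hd', ← add_smul]
      congr 1; push_cast; ring
    obtain ⟨a, ha, b, hb, rfl⟩ := Submodule.mem_sup.1 h1
    rw [map_add]
    refine Submodule.add_mem _ ?_ ?_
    · obtain ⟨t, rfl⟩ := Submodule.mem_span_singleton.1 ha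
      rw [map_smul]
      exact Submodule.smul_mem _ _ (step 0 x (by rw [h.height, Nat.cast_zero, add_zero]))
    · refine (iSup_le fun n z hz => ?_ : _ ≤ (⨆ n : ℕ, ρ.height.eigenspace
        (m + (n + 1))).comap (ρ.e I J)) hb
      exact step (n + 1) z (by simpa using Module.End.mem_eigenspace_iff.1 hz)

/-- The highest weight space of `generated x` is spanned by `x`. -/
theorem exists_smul_of_mem_generated {ρ : ParityRep p q V} {μ : Idx p q → ℂ} {x y : V}
    (h : ρ.IsHW μ x) (hy : ρ.IsHW μ y) (hmem : y ∈ ρ.generated x) : ∃ c : ℂ, c • x = y := by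
  obtain ⟨a, ha, b, hb, rfl⟩ := Submodule.mem_sup.1 (generated_le_eigenspaces h hmem)
  obtain ⟨t, rfl⟩ := Submodule.mem_span_singleton.1 ha
  refine ⟨t, ?_⟩
  -- The part `b` is a difference of two vectors of the same height, yet it also lies in the sum of
  -- the other eigenspaces, so it vanishes.
  have hb' : b ∈ ρ.height.eigenspace (∑ I, (position I : ℂ) * μ I) := by
    have := Submodule.sub_mem _ (Module.End.mem_eigenspace_iff.2 hy.height)
      (Module.End.mem_eigenspace_iff.2 (h.smul t).height)
    simpa using this
  have hind := ρ.height.eigenspaces_iSupIndep (∑ I, (position I : ℂ) * μ I)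
  have : b = 0 := by
    refine Submodule.disjoint_def.1 hind b hb' ?_
    refine (iSup_le fun n => ?_ : (⨆ n : ℕ, ρ.height.eigenspace
      ((∑ I, (position I : ℂ) * μ I) + (n + 1))) ≤ _) hb
    refine le_iSup₂_of_le (f := fun (j : ℂ) (_ : j ≠ ∑ I, (position I : ℂ) * μ I) =>
      ρ.height.eigenspace j) _ ?_ le_rfl
    intro hn
    have : ((n : ℂ) + 1) = 0 := by simpa using hn
    exact Nat.cast_add_one_ne_zero n this
  rw [this, add_zero]

/-- An irreducible representation is finite dimensional if there is another representation with
a highest weight vector of the same weight that lies in a finite dimensional stable subspace. -/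
theorem finiteDimensional_of_irreducible {ρ : ParityRep p q V} {τ : ParityRep p q N}
    {μ : Idx p q → ℂ} {v : V} {w : N} (hirr : ∀ W, ρ.Stable W → W = ⊥ ∨ W = ⊤) (hv0 : v ≠ 0)
    (hw0 : w ≠ 0) (hv : ρ.IsHW μ v) (hw : τ.IsHW μ w) {G : Submodule ℂ N} (hG : τ.Stable G)
    (hwG : w ∈ G) [FiniteDimensional ℂ G] : FiniteDimensional ℂ V := by
  have htop : ρ.Stable ⊤ := ⟨fun _ _ => trivial, fun _ _ _ _ => trivial⟩
  obtain ⟨v, -, c, hc, hv0, hv, hvP⟩ := exists_homogeneous_hw hv htop trivial hv0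
  obtain ⟨w, hwG, d, hd, hw0, hw, hwP⟩ := exists_homogeneous_hw hw hG hwG hw0
  -- Rescaling the involution on `N` by `c * d` turns the parity `d` of `w` into the parity `c` of
  -- `v`, which makes `(v, w)` homogeneous.
  have hcd : (c * d) * (c * d) = 1 := by rw [mul_mul_mul_comm, hc, hd, one_mul]
  let σ := ρ.prod (τ.twist (c * d) hcd)
  have hx : σ.IsHW μ (v, w) :=
    ⟨fun I => Prod.ext (hv.1 I) (hw.1 I), fun I J h => Prod.ext (hv.2 I J h) (hw.2 I J h)⟩
  have hxP : σ.P (v, w) = c • (v, w) := by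
    refine Prod.ext hvP ?_
    change (c * d) • τ.P w = c • w
    rw [hwP, smul_smul, mul_assoc, hd, mul_one]
  set U := σ.generated (v, w)
  have hU : σ.Stable U := generated_stable hx hxP
  -- If `U` contained all of `V ⊕ 0`, then `(v, 0)` would be a highest weight vector in `U` not
  -- proportional to `(v, w)`.
  have hker : U.comap (LinearMap.inl ℂ V N) = ⊥ := by
    refine (hirr _ ⟨fun y hy => ?_, fun I J y hy => ?_⟩).resolve_right fun htop => ?_
    · have := hU.1 _ hy
      simpa [σ, prod] using this
    · have := hU.2 I J _ hy
      simpa [σ, prod] using this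
    · have hmem : (v, (0 : N)) ∈ U := by
        have : v ∈ U.comap (LinearMap.inl ℂ V N) := htop ▸ trivial
        simpa using this
      have hy : σ.IsHW μ (v, 0) :=
        ⟨fun I => Prod.ext (hv.1 I) (by simp [σ, prod]),
          fun I J h => Prod.ext (hv.2 I J h) (by simp [σ, prod])⟩
      obtain ⟨t, ht⟩ := exists_smul_of_mem_generated hx hy hmem
      have h1 : t • v = v := congrArg Prod.fst ht
      have h2 : t • w = 0 := congrArg Prod.snd ht
      rcases smul_eq_zero.1 h2 with rfl | h2
      · exact hv0 (by rw [← h1, zero_smul])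
      · exact hw0 h2
  have hrange : U.map (LinearMap.fst ℂ V N) = ⊤ := by
    refine (hirr _ ⟨?_, ?_⟩).resolve_left fun hbot => ?_
    · rintro _ ⟨y, hy, rfl⟩
      exact ⟨_, hU.1 y hy, rfl⟩
    · rintro I J _ ⟨y, hy, rfl⟩
      exact ⟨_, hU.2 I J y hy, rfl⟩
    · have : v ∈ U.map (LinearMap.fst ℂ V N) := ⟨(v, w), self_mem_generated σ _, rfl⟩
      rw [hbot] at this
      exact hv0 ((Submodule.mem_bot ℂ).1 this)
  have hUG : U ≤ G.comap (LinearMap.snd ℂ V N) := by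
    refine generated_le ⟨fun y hy => ?_, fun I J y hy => ?_⟩ hwG
    · exact G.smul_mem _ (hG.1 _ hy)
    · exact hG.2 I J _ hy
  let f : U →ₗ[ℂ] G := (LinearMap.snd ℂ V N).restrict hUG
  have hf : Function.Injective f := by
    rw [injective_iff_map_eq_zero]
    rintro ⟨⟨y, z⟩, hyz⟩ h0
    have hz : z = 0 := congrArg Subtype.val h0
    subst hz
    have : y ∈ U.comap (LinearMap.inl ℂ V N) := hyz
    rw [hker, Submodule.mem_bot] at this
    subst this
    rfl
  have : FiniteDimensional ℂ U := Module.Finite.of_injective f hf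
  have : FiniteDimensional ℂ (U.map (LinearMap.fst ℂ V N)) := inferInstance
  rw [hrange] at this
  exact Module.finite_def.2 (Module.Finite.iff_fg.1 this)

/-- A representation with a highest weight vector has an irreducible subquotient of that highest
weight. -/
theorem exists_irreducible {V : Type} [AddCommGroup V] [Module ℂ V] {ρ : ParityRep p q V}
    {μ : Idx p q → ℂ} {v : V} (hv : ρ.IsHW μ v) (hv0 : v ≠ 0) :
    ∃ (N : Type) (_ : AddCommGroup N) (_ : Module ℂ N) (τ : ParityRep p q N) (w : N),
      (∀ W, τ.Stable W → W = ⊥ ∨ W = ⊤) ∧ w ≠ 0 ∧ τ.IsHW μ w := by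
  have htop : ρ.Stable ⊤ := ⟨fun _ _ => trivial, fun _ _ _ _ => trivial⟩
  obtain ⟨v, -, c, hc, hv0, hv, hvP⟩ := exists_homogeneous_hw hv htop trivial hv0
  obtain ⟨K, -, hK⟩ := zorn_le_nonempty₀ {W : Submodule ℂ V | ρ.Stable W ∧ v ∉ W} (by
    intro C hC hchain y hy
    have hne : C.Nonempty := ⟨y, hy⟩
    have hmem : ∀ z, z ∈ sSup C ↔ ∃ W ∈ C, z ∈ W := fun z =>
      Submodule.mem_sSup_of_directed hne hchain.directedOn
    refine ⟨sSup C, ⟨⟨fun z hz => ?_, fun I J z hz => ?_⟩, fun hz => ?_⟩, fun _ => le_sSup⟩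
    · obtain ⟨W, hW, hz⟩ := (hmem z).1 hz
      exact (hmem _).2 ⟨W, hW, (hC hW).1.1 z hz⟩
    · obtain ⟨W, hW, hz⟩ := (hmem z).1 hz
      exact (hmem _).2 ⟨W, hW, (hC hW).1.2 I J z hz⟩
    · obtain ⟨W, hW, hz⟩ := (hmem _).1 hz
      exact (hC hW).2 hz) ⊥ ⟨⟨by simp, by simp⟩, by simpa using hv0⟩
  obtain ⟨hKs, hvK⟩ := hK.prop
  let σ := ρ.quotient K hKs
  set w : V ⧸ K := K.mkQ v with hw
  have hw0 : w ≠ 0 := by simpa [hw] using hvK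
  have hwh : σ.IsHW μ w := by
    refine ⟨fun I => ?_, fun I J h => ?_⟩
    · change K.mkQ (ρ.e I I v) = _
      rw [hv.1, map_smul]
    · change K.mkQ (ρ.e I J v) = _
      rw [hv.2 I J h, map_zero]
  have hwP : σ.P w = c • w := by
    change K.mkQ (ρ.P v) = _
    rw [hvP, map_smul]
  -- The preimage of a stable subspace avoiding `w` contains `K` and avoids `v`, so it equals `K` by
  -- maximality.
  have hmin : ∀ W, σ.Stable W → W ≠ ⊥ → w ∈ W := by
    intro W hW hWne
    by_contra hwW
    have hle : W.comap K.mkQ ≤ K := hK.le_of_ge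
      ⟨⟨fun z hz => hW.1 _ hz, fun I J z hz => hW.2 I J _ hz⟩, hwW⟩ (by
        intro z hz
        change K.mkQ z ∈ W
        rw [show K.mkQ z = 0 by simpa using hz]
        exact W.zero_mem)
    refine hWne (le_bot_iff.1 fun z hz => ?_)
    obtain ⟨y, rfl⟩ := K.mkQ_surjective z
    simpa using hle hz
  have hU : σ.Stable (σ.generated w) := generated_stable hwh hwP
  refine ⟨σ.generated w, inferInstance, inferInstance, σ.restrict _ hU,
    ⟨w, self_mem_generated σ w⟩, fun W hW => ?_, fun h => hw0 (congrArg Subtype.val h),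
    fun I => Subtype.ext (hwh.1 I), fun I J h => Subtype.ext (hwh.2 I J h)⟩
  by_cases hWb : W = ⊥
  · exact .inl hWb
  have hst : σ.Stable (W.map (σ.generated w).subtype) := by
    refine ⟨?_, ?_⟩
    · rintro _ ⟨y, hy, rfl⟩
      exact ⟨_, hW.1 y hy, rfl⟩
    · rintro I J _ ⟨y, hy, rfl⟩
      exact ⟨_, hW.2 I J y hy, rfl⟩
  have hmem := hmin _ hst (by
    intro h
    refine hWb (le_bot_iff.1 fun z hz => ?_)
    have : (z : V ⧸ K) ∈ W.map (σ.generated w).subtype := ⟨z, hz, rfl⟩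
    rw [h, Submodule.mem_bot] at this
    exact Subtype.ext this)
  refine .inr (eq_top_iff.2 fun y _ => ?_)
  obtain ⟨z, hz, hzy⟩ := generated_le hst hmem y.2
  rwa [← Subtype.ext hzy]

/-! ### Comparison with `SuperModule` -/

/-- The action of a matrix. -/
def act (ρ : ParityRep p q V) : GlMatrix p q →ₗ[ℂ] Module.End ℂ V where
  toFun A := ∑ I, ∑ J, A I J • ρ.e I J
  map_add' A B := by simp [add_smul, Finset.sum_add_distrib]
  map_smul' c A := by simp [Finset.smul_sum, smul_smul]

theorem act_apply (ρ : ParityRep p q V) (A : GlMatrix p q) (v : V) :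
    ρ.act A v = ∑ I, ∑ J, A I J • ρ.e I J v := by
  simp only [act, LinearMap.coe_mk, AddHom.coe_mk, LinearMap.sum_apply, LinearMap.smul_apply]

theorem act_single (ρ : ParityRep p q V) (I J : Idx p q) (c : ℂ) :
    ρ.act (Matrix.single I J c) = c • ρ.e I J := by
  change ∑ K, ∑ L, Matrix.single I J c K L • ρ.e K L = _
  rw [Finset.sum_eq_single I, Finset.sum_eq_single J] <;>
    simp +contextual [Matrix.single, Ne.symm, eq_comm]

/-- The homogeneous components for a parity involution. -/
def component (ρ : ParityRep p q V) (d : ZMod 2) : Submodule ℂ V :=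
  ρ.P.eigenspace (sign d 1)

theorem mem_component {ρ : ParityRep p q V} {d : ZMod 2} {v : V} :
    v ∈ ρ.component d ↔ ρ.P v = sign d 1 • v :=
  Module.End.mem_eigenspace_iff

theorem component_isInternal (ρ : ParityRep p q V) : DirectSum.IsInternal ρ.component := by
  rw [DirectSum.isInternal_submodule_iff_isCompl (i := 0) (j := 1) _ (by decide)
    univ_zmod_two]
  constructor
  · rw [Submodule.disjoint_def]
    intro v h0 h1
    rw [mem_component] at h0 h1
    have h2 : v = -v := by simpa [sign, ZMod.val_one] using h0.symm.trans h1
    exact eq_zero_of_eq_neg h2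
  · rw [codisjoint_iff, eq_top_iff]
    intro v _
    refine Submodule.mem_sup.2 ⟨(1 / 2 : ℂ) • (v + ρ.P v), ?_, (1 / 2 : ℂ) • (v - ρ.P v), ?_, ?_⟩
    · simp [mem_component, sign, ρ.P_P, add_comm]
    · simp [mem_component, sign, ρ.P_P, ZMod.val_one]
    · rw [← smul_add, add_add_sub_cancel, ← two_smul ℂ v, smul_smul]; norm_num

/-- Entries of the wrong parity vanish, so additive statements about homogeneous matrices reduce to
matrix units of the same parity. -/
theorem single_induction {a : ZMod 2} {A : GlMatrix p q} (hA : A ∈ homogeneous p q a)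
    {C : GlMatrix p q → Prop} (h0 : C 0) (hadd : ∀ A B, C A → C B → C (A + B))
    (hs : ∀ I J c, parity I + parity J = a → C (Matrix.single I J c)) : C A := by
  rw [Matrix.matrix_eq_sum_single A]
  refine Finset.sum_induction _ C hadd h0 fun I _ =>
    Finset.sum_induction _ C hadd h0 fun J _ => ?_
  by_cases h : parity I + parity J = a
  · exact hs I J _ h
  · rw [hA I J h, Matrix.single_zero]; exact h0

/-- The `SuperModule` defined by a representation. -/
def toSuperModule (ρ : ParityRep p q V) : SuperModule p q V where
  grading := ρ.component
  isInternal := ρ.component_isInternal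
  act := ρ.act
  act_mem a b A v hA hv := by
    refine single_induction hA (C := fun A => ρ.act A v ∈ ρ.component (a + b)) ?_ ?_ ?_
    · simp
    · intro A B h1 h2
      rw [map_add]
      exact Submodule.add_mem _ h1 h2
    · rintro I J c rfl
      rw [act_single]
      refine Submodule.smul_mem _ c ?_
      rw [mem_component] at hv ⊢
      rw [ρ.P_e, hv, map_smul, smul_smul, ← sign_add_left]
  act_superBracket a b A B hA hB := by
    refine single_induction hA (C := fun A => ρ.act (superBracket a b A B) =
      ρ.act A * ρ.act B - sign a b • (ρ.act B * ρ.act A)) ?_ ?_ ?_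
    · simp [superBracket]
    · intro A A' h1 h2
      have : superBracket a b (A + A') B = superBracket a b A B + superBracket a b A' B := by
        simp only [superBracket, add_mul, mul_add, smul_add]; abel
      rw [this, map_add, h1, h2, map_add]
      simp only [add_mul, mul_add, smul_add]; abel
    rintro I J c rfl
    refine single_induction hB (C := fun B => ρ.act (superBracket _ b (Matrix.single I J c) B) =
      ρ.act (Matrix.single I J c) * ρ.act B -
        sign _ b • (ρ.act B * ρ.act (Matrix.single I J c))) ?_ ?_ ?_
    · simp [superBracket]
    · intro A A' h1 h2
      have : superBracket (parity I + parity J) b (Matrix.single I J c) (A + A') =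
          superBracket (parity I + parity J) b (Matrix.single I J c) A +
          superBracket (parity I + parity J) b (Matrix.single I J c) A' := by
        simp only [superBracket, add_mul, mul_add, smul_add]; abel
      rw [this, map_add, h1, h2, map_add]
      simp only [add_mul, mul_add, smul_add]; abel
    rintro K L d rfl
    ext v
    have hm : ∀ (I J K L : Idx p q) (c d : ℂ), ρ.act (Matrix.single I J c * Matrix.single K L d) =
        (c * d) • (if J = K then ρ.e I L else 0) := by
      intro I J K L c d
      split_ifs with h
      · subst h
        rw [Matrix.single_mul_single_same, act_single]
      · rw [Matrix.single_mul_single_of_ne _ _ _ _ h]; simp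
    rw [superBracket, map_sub, map_smul, hm, hm, act_single, act_single]
    simp only [LinearMap.sub_apply, LinearMap.smul_apply, Module.End.mul_apply, map_smul]
    rw [ρ.e_e I J K L v]
    split_ifs <;> (try simp only [LinearMap.zero_apply]) <;> module

theorem toSuperModule_isIrreducible {ρ : ParityRep p q V} [Nontrivial V]
    (h : ∀ W, ρ.Stable W → W = ⊥ ∨ W = ⊤) : ρ.toSuperModule.IsIrreducible := by
  refine ⟨inferInstance, fun W hW => h W ⟨fun v hv => ?_, fun I J v hv => ?_⟩⟩
  · have h1 := hW.1 hv
    suffices (⨆ d, W ⊓ ρ.component d) ≤ W.comap ρ.P by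
      rw [toSuperModule] at h1
      exact this h1
    refine iSup_le fun d y hy => ?_
    change ρ.P y ∈ W
    rw [mem_component.1 hy.2]
    exact W.smul_mem _ hy.1
  · have := hW.2 (Matrix.single I J 1) v hv
    rwa [toSuperModule, act_single, one_smul] at this

theorem toSuperModule_isHighestWeightVector {ρ : ParityRep p q V} {μ : Idx p q → ℂ} {v : V}
    (h : ρ.IsHW μ v) (h0 : v ≠ 0) :
    ρ.toSuperModule.IsHighestWeightVector (borelNaturalMinus p q) μ v := by
  refine ⟨h0, fun A hA => ?_⟩
  rw [toSuperModule, act_apply, Finset.sum_smul]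
  refine Finset.sum_congr rfl fun I _ => ?_
  rw [Finset.sum_eq_single I]
  · rw [h.1, smul_smul, mul_comm]
  · intro J _ hJ
    rcases lt_trichotomy (position I) (position J) with hlt | heq | hgt
    · rw [h.2 I J hlt, smul_zero]
    · exact absurd (position_injective heq).symm hJ
    · rw [hA I J hgt, zero_smul]
  · simp

end ParityRep

/-! ### From supermodules back to matrix units and a parity involution. -/

namespace SuperModule

variable {V : Type*} [AddCommGroup V] [Module ℂ V]

theorem isCompl_grading (M : SuperModule p q V) : IsCompl (M.grading 0) (M.grading 1) :=
  M.isInternal.isCompl (by decide) univ_zmod_two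

/-- The parity involution of a `SuperModule`. -/
noncomputable def parityInvolution (M : SuperModule p q V) : Module.End ℂ V :=
  LinearMap.ofIsCompl M.isCompl_grading (M.grading 0).subtype (-(M.grading 1).subtype)

theorem parityInvolution_of_mem (M : SuperModule p q V) {d : ZMod 2} {v : V}
    (hv : v ∈ M.grading d) : M.parityInvolution v = sign d 1 • v := by
  rcases zmod_two_cases d with rfl | rfl
  · have := LinearMap.ofIsCompl_apply_left M.isCompl_grading
      (φ := (M.grading 0).subtype) (ψ := -(M.grading 1).subtype) ⟨v, hv⟩
    simpa [sign, parityInvolution] using this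
  · have := LinearMap.ofIsCompl_apply_right M.isCompl_grading
      (φ := (M.grading 0).subtype) (ψ := -(M.grading 1).subtype) ⟨v, hv⟩
    simpa [sign, parityInvolution, ZMod.val_one] using this

theorem homogeneous_induction (M : SuperModule p q V) {C : V → Prop}
    (hadd : ∀ v w, C v → C w → C (v + w)) (h : ∀ d, ∀ v ∈ M.grading d, C v) (v : V) : C v := by
  obtain ⟨a, b, rfl, -⟩ := Submodule.existsUnique_add_of_isCompl M.isCompl_grading v
  exact hadd _ _ (h 0 a a.2) (h 1 b b.2)

theorem single_mem_homogeneous (I J : Idx p q) (c : ℂ) :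
    Matrix.single I J c ∈ homogeneous p q (parity I + parity J) := by
  intro K L h
  rw [Matrix.single_apply, if_neg]
  rintro ⟨rfl, rfl⟩
  exact h rfl

/-- The representation underlying a `SuperModule`. -/
noncomputable def toParityRep (M : SuperModule p q V) : ParityRep p q V where
  P := M.parityInvolution
  e I J := M.act (Matrix.single I J 1)
  P_P := M.homogeneous_induction (fun v w h1 h2 => by rw [map_add, map_add, h1, h2])
    fun d v hv => by
      rw [M.parityInvolution_of_mem hv, map_smul, M.parityInvolution_of_mem hv, smul_smul,
        sign_mul_self, one_smul]
  P_e I J := M.homogeneous_induction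
    (fun v w h1 h2 => by simp only [map_add, smul_add, h1, h2])
    fun d v hv => by
      rw [M.parityInvolution_of_mem hv, M.parityInvolution_of_mem
        (M.act_mem _ d _ v (single_mem_homogeneous I J 1) hv), map_smul, smul_smul, sign_add_left]
  e_e I J K L v := by
    have h := congrArg (fun f => f v) (M.act_superBracket _ _ _ _ (single_mem_homogeneous I J 1)
      (single_mem_homogeneous K L 1))
    have hm : ∀ (I J K L : Idx p q), M.act (Matrix.single I J 1 * Matrix.single K L 1) v =
        if J = K then M.act (Matrix.single I L 1) v else 0 := by
      intro I J K L
      split_ifs with h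
      · subst h
        rw [Matrix.single_mul_single_same, one_mul]
      · rw [Matrix.single_mul_single_of_ne _ _ _ _ h]; simp
    simp only [superBracket, map_sub, map_smul, LinearMap.sub_apply, LinearMap.smul_apply, hm,
      Module.End.mul_apply] at h
    rw [h]; abel

/-- A subspace stable under the involution is graded: the even part of `v` is half of `v + P v`. -/
theorem toParityRep_irreducible {M : SuperModule p q V} (h : M.IsIrreducible) (W : Submodule ℂ V)
    (hW : M.toParityRep.Stable W) : W = ⊥ ∨ W = ⊤ := by
  refine h.2 W ⟨fun v hv => ?_, fun A v hv => ?_⟩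
  · obtain ⟨a, b, rfl, -⟩ := Submodule.existsUnique_add_of_isCompl M.isCompl_grading v
    have hP : M.parityInvolution ((a : V) + b) = a - b := by
      rw [map_add, M.parityInvolution_of_mem a.2, M.parityInvolution_of_mem b.2]
      simp [sign, ZMod.val_one, sub_eq_add_neg]
    have hP' : (a : V) - b ∈ W := hP ▸ hW.1 _ hv
    have ha : (a : V) ∈ W := by
      have := W.smul_mem (1 / 2 : ℂ) (W.add_mem hv hP')
      rwa [add_add_sub_cancel, ← two_smul ℂ (a : V), smul_smul, one_div,
        inv_mul_cancel₀ two_ne_zero, one_smul] at this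
    have hb : (b : V) ∈ W := (W.add_mem_iff_right ha).1 hv
    exact Submodule.add_mem _
      (Submodule.mem_iSup_of_mem (p := fun d => W ⊓ M.grading d) 0 ⟨ha, a.2⟩)
      (Submodule.mem_iSup_of_mem (p := fun d => W ⊓ M.grading d) 1 ⟨hb, b.2⟩)
  · rw [Matrix.matrix_eq_sum_single A, map_sum, LinearMap.sum_apply]
    refine W.sum_mem fun I _ => ?_
    rw [map_sum, LinearMap.sum_apply]
    refine W.sum_mem fun J _ => ?_
    rw [show Matrix.single I J (A I J) = A I J • Matrix.single I J (1 : ℂ) by simp, map_smul]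
    exact W.smul_mem _ (hW.2 I J v hv)

theorem toParityRep_isHW {M : SuperModule p q V} {μ : Idx p q → ℂ} {v : V}
    (h : M.IsHighestWeightVector (borelNaturalMinus p q) μ v) : M.toParityRep.IsHW μ v := by
  have hb : ∀ I J : Idx p q, position I ≤ position J →
      Matrix.single I J (1 : ℂ) ∈ borelNaturalMinus p q := by
    intro I J hIJ K L hKL
    rw [Matrix.single_apply, if_neg]
    rintro ⟨rfl, rfl⟩
    omega
  refine ⟨fun I => ?_, fun I J hIJ => ?_⟩
  · refine (h.2 _ (hb I I le_rfl)).trans ?_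
    congr 1
    rw [Finset.sum_eq_single I] <;> simp +contextual [eq_comm]
  · refine (h.2 _ (hb I J hIJ.le)).trans ?_
    have hne : I ≠ J := by rintro rfl; omega
    rw [Finset.sum_eq_zero, zero_smul]
    intro K _
    rw [Matrix.single_apply, if_neg, mul_zero]
    rintro ⟨rfl, rfl⟩
    exact hne rfl

end SuperModule

/-- Existence and finite dimensionality of irreducible modules follow from a highest weight vector
in a finite dimensional stable subspace of some representation. -/
theorem exists_irreducible_and_finiteDimensional {F : Type} [AddCommGroup F] [Module ℂ F]
    {ρ : ParityRep p q F} {μ : Idx p q → ℂ} {w : F} (hw : ρ.IsHW μ w) (hw0 : w ≠ 0)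
    {G : Submodule ℂ F} (hG : ρ.Stable G) (hwG : w ∈ G) [FiniteDimensional ℂ G] :
    (∃ (V : Type) (_ : AddCommGroup V) (_ : Module ℂ V) (M : SuperModule p q V),
      M.IsIrreducibleOfHighestWeight (borelNaturalMinus p q) μ) ∧
    ∀ (V : Type*) [AddCommGroup V] [Module ℂ V] (M : SuperModule p q V),
      M.IsIrreducibleOfHighestWeight (borelNaturalMinus p q) μ → FiniteDimensional ℂ V := by
  constructor
  · obtain ⟨N, _, _, τ, v, hirr, hv0, hv⟩ := ParityRep.exists_irreducible hw hw0
    have : Nontrivial N := ⟨⟨v, 0, hv0⟩⟩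
    exact ⟨N, inferInstance, inferInstance, τ.toSuperModule,
      ParityRep.toSuperModule_isIrreducible hirr, v,
      ParityRep.toSuperModule_isHighestWeightVector hv hv0⟩
  · rintro V _ _ M ⟨hirr, v, hv⟩
    exact ParityRep.finiteDimensional_of_irreducible
      (SuperModule.toParityRep_irreducible hirr) hv.1 hw0
      (SuperModule.toParityRep_isHW hv) hw hG hwG

/-! ### Oscillator representations -/

/-- The sign in the exchange relation of two oscillators: the oscillators attached to even
coordinates are fermions, those attached to odd coordinates are bosons. -/
def oscSign (I J : Idx p q) : ℂ := sign (parity I + 1) (parity J + 1)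

theorem oscSign_comm (I J : Idx p q) : oscSign I J = oscSign J I := sign_comm _ _

theorem oscSign_mul_self (I J : Idx p q) : oscSign I J * oscSign I J = 1 := sign_mul_self _ _

@[simp] theorem oscSign_inl_inl (i j : Fin p ⊕ Fin p) :
    oscSign (Sum.inl i : Idx p q) (Sum.inl j) = -1 := by
  simp [oscSign, parity, sign_one_one]

@[simp] theorem oscSign_inr_left (i : Fin q ⊕ Fin q) (J : Idx p q) :
    oscSign (Sum.inr i) J = 1 := by
  simp [oscSign, parity, show (1 + 1 : ZMod 2) = 0 from rfl, sign_zero_left]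

@[simp] theorem oscSign_inr_right (i : Fin q ⊕ Fin q) (J : Idx p q) :
    oscSign J (Sum.inr i) = 1 := by
  rw [oscSign_comm, oscSign_inr_left]

/-- The Koszul sign of two matrix units is the product of the four signs from moving one pair of
oscillators past the other. Shifting all parities by one does not change the parity of a pair. -/
theorem sign_parity_add (I J K L : Idx p q) :
    sign (parity I + parity J) (parity K + parity L) =
      oscSign I K * oscSign I L * (oscSign J K * oscSign J L) := by
  have h : ∀ a b : ZMod 2, a + b = (a + 1) + (b + 1) := by decide
  rw [h (parity I), h (parity K), sign_add_left, sign_add_right _ (parity K + 1),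
    sign_add_right _ (parity K + 1)]
  rfl

/-- The supertrace sign of a coordinate. -/
def superSign (I : Idx p q) : ℂ := sign (parity I) 1

@[simp] theorem superSign_inl (i : Fin p ⊕ Fin p) : superSign (Sum.inl i : Idx p q) = 1 :=
  sign_zero_left _

@[simp] theorem superSign_inr (i : Fin q ⊕ Fin q) : superSign (Sum.inr i : Idx p q) = -1 :=
  sign_one_one

/-- Families of creation and annihilation operators, fermionic for the even coordinates and bosonic
for the odd ones. -/
structure Oscillators (p q : ℕ) (C F : Type*) [DecidableEq C] [AddCommGroup F] [Module ℂ F] where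
  /-- the parity involution -/
  P : Module.End ℂ F
  /-- the creation operators -/
  α : Idx p q → C → Module.End ℂ F
  /-- the annihilation operators -/
  β : Idx p q → C → Module.End ℂ F
  P_P : ∀ v, P (P v) = v
  P_α : ∀ I c v, P (α I c v) = sign (parity I + 1) 1 • α I c (P v)
  P_β : ∀ I c v, P (β I c v) = sign (parity I + 1) 1 • β I c (P v)
  α_α : ∀ I c K d v, α I c (α K d v) = oscSign I K • α K d (α I c v)
  β_β : ∀ I c K d v, β I c (β K d v) = oscSign I K • β K d (β I c v)
  β_α : ∀ I c K d v, β I c (α K d v) =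
    (if I = K ∧ c = d then v else 0) + oscSign I K • α K d (β I c v)

namespace Oscillators

variable {C F : Type*} [DecidableEq C] [AddCommGroup F] [Module ℂ F]

section

variable [Fintype C]

/-- The bilinear expressions `∑ α β`. -/
def bilinear (O : Oscillators p q C F) (I J : Idx p q) : Module.End ℂ F :=
  ∑ c, O.α I c * O.β J c

theorem bilinear_apply (O : Oscillators p q C F) (I J : Idx p q) (v : F) :
    O.bilinear I J v = ∑ c, O.α I c (O.β J c v) := by
  simp [bilinear]

/-- Normal ordering: the single contraction of `β J` with `α K` gives the matrix product, and the
remainder is a normally ordered quartic term. -/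
theorem bilinear_bilinear (O : Oscillators p q C F) (I J K L : Idx p q) (v : F) :
    O.bilinear I J (O.bilinear K L v) = (if J = K then O.bilinear I L v else 0) +
      oscSign J K • ∑ c, ∑ d, O.α I c (O.α K d (O.β J c (O.β L d v))) := by
  simp only [bilinear_apply, map_sum, O.β_α J _ K, map_add, Finset.sum_add_distrib, map_smul,
    ← Finset.smul_sum]
  rw [Finset.sum_comm (f := fun d c => O.α I c (O.α K d (O.β J c (O.β L d v))))]
  congr 1
  by_cases h : J = K
  · simp only [h, true_and, if_true]
    refine Finset.sum_congr rfl fun c _ => ?_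
    rw [Finset.sum_eq_single c] <;> simp +contextual [eq_comm]
  · simp [h]

/-- The representation given by the bilinear expressions. -/
def toParityRep (O : Oscillators p q C F) : ParityRep p q F where
  P := O.P
  e := O.bilinear
  P_P := O.P_P
  P_e I J v := by
    have h : ∀ a b : ZMod 2, a + b = (a + 1) + (b + 1) := by decide
    rw [h (parity I)]
    simp only [bilinear_apply, map_sum, O.P_α, O.P_β, map_smul, smul_smul, Finset.smul_sum,
      sign_add_left (parity I + 1)]
  e_e I J K L v := by
    rw [bilinear_bilinear, bilinear_bilinear]
    -- The quartic terms of the two products agree up to sign, so they cancel in the supercommutator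
    -- and only the contractions survive.
    have h : ∑ c, ∑ d, O.α K c (O.α I d (O.β L c (O.β J d v))) =
        (oscSign K I * oscSign L J) • ∑ c, ∑ d, O.α I c (O.α K d (O.β J c (O.β L d v))) := by
      rw [Finset.sum_comm, Finset.smul_sum]
      refine Finset.sum_congr rfl fun c _ => ?_
      rw [Finset.smul_sum]
      refine Finset.sum_congr rfl fun d _ => ?_
      rw [O.α_α K, O.β_β L, map_smul, map_smul, smul_smul]
    have hs : sign (parity I + parity J) (parity K + parity L) *
        (oscSign L I * (oscSign K I * oscSign L J)) = oscSign J K := by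
      rw [sign_parity_add, oscSign_comm K I, oscSign_comm L I, oscSign_comm L J]
      linear_combination (oscSign J K) * (oscSign I L * oscSign I L * (oscSign J L * oscSign J L)) *
        oscSign_mul_self I K + oscSign J K * (oscSign J L * oscSign J L) * oscSign_mul_self I L +
        oscSign J K * oscSign_mul_self J L
    rw [h, smul_add, smul_smul, smul_smul, mul_assoc, hs]
    abel

end

/-! ### The filtration by number of creation operators. -/

section

variable (O : Oscillators p q C F) (vac : F)

/-- The span of the vectors obtained from the vacuum by at most `n` creation operators. -/
def level : ℕ → Submodule ℂ F
  | 0 => Submodule.span ℂ {vac}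
  | n + 1 => level n ⊔ ⨆ I, ⨆ c, (level n).map (O.α I c)

instance level_finiteDimensional [Finite C] : ∀ n, FiniteDimensional ℂ (O.level vac n)
  | 0 => by rw [level]; infer_instance
  | n + 1 => by
    have := level_finiteDimensional n
    rw [level]; infer_instance

variable {O vac}

theorem level_mono : Monotone (O.level vac) :=
  monotone_nat_of_le_succ fun _ => le_sup_left

theorem α_mem_level (I : Idx p q) (c : C) {n : ℕ} {v : F} (hv : v ∈ O.level vac n) :
    O.α I c v ∈ O.level vac (n + 1) :=
  Submodule.mem_sup_right (Submodule.mem_iSup_of_mem I (Submodule.mem_iSup_of_mem c ⟨v, hv, rfl⟩))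

theorem level_succ_le {n : ℕ} {W : Submodule ℂ F} (h : O.level vac n ≤ W)
    (h' : ∀ I c, ∀ v ∈ O.level vac n, O.α I c v ∈ W) : O.level vac (n + 1) ≤ W := by
  refine sup_le h (iSup_le fun I => iSup_le fun c => ?_)
  rintro _ ⟨v, hv, rfl⟩
  exact h' I c v hv

theorem β_of_mem_level_zero (hvac : ∀ I c, O.β I c vac = 0) (J : Idx p q) (d : C) {v : F}
    (hv : v ∈ O.level vac 0) : O.β J d v = 0 := by
  obtain ⟨t, rfl⟩ := Submodule.mem_span_singleton.1 hv
  rw [map_smul, hvac, smul_zero]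

/-- Moving `β` past one `α` leaves a contraction, already in the lower level, and a term `α β`
controlled by induction. -/
theorem β_mem_level (hvac : ∀ I c, O.β I c vac = 0) (J : Idx p q) (d : C) (n : ℕ) :
    ∀ v ∈ O.level vac (n + 1), O.β J d v ∈ O.level vac n := by
  have key : ∀ n, (∀ I c, ∀ v ∈ O.level vac n, O.α I c (O.β J d v) ∈ O.level vac n) →
      O.level vac n ≤ (O.level vac n).comap (O.β J d) →
      O.level vac (n + 1) ≤ (O.level vac n).comap (O.β J d) := by
    intro n h h0
    refine level_succ_le h0 fun I c v hv => ?_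
    change O.β J d (O.α I c v) ∈ O.level vac n
    rw [O.β_α]
    refine Submodule.add_mem _ ?_ (Submodule.smul_mem _ _ (h I c v hv))
    split_ifs
    · exact hv
    · exact Submodule.zero_mem _
  induction n with
  | zero =>
    refine key 0 (fun I c v hv => ?_) fun v hv => ?_
    · rw [β_of_mem_level_zero hvac J d hv, map_zero]
      exact Submodule.zero_mem _
    · rw [Submodule.mem_comap, β_of_mem_level_zero hvac J d hv]
      exact Submodule.zero_mem _
  | succ n ih =>
    exact key (n + 1) (fun I c v hv => α_mem_level I c (ih v hv))
      fun v hv => level_mono n.le_succ (ih v hv)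

theorem α_β_mem_level (hvac : ∀ I c, O.β I c vac = 0) (I J : Idx p q) (c d : C) {n : ℕ} {v : F}
    (hv : v ∈ O.level vac n) : O.α I c (O.β J d v) ∈ O.level vac n := by
  cases n with
  | zero =>
    rw [β_of_mem_level_zero hvac J d hv, map_zero]
    exact Submodule.zero_mem _
  | succ n => exact α_mem_level I c (β_mem_level hvac J d n v hv)

theorem P_mem_level (hP : O.P vac = vac) (n : ℕ) : ∀ v ∈ O.level vac n, O.P v ∈ O.level vac n := by
  induction n with
  | zero =>
    intro v hv
    obtain ⟨t, rfl⟩ := Submodule.mem_span_singleton.1 hv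
    rw [map_smul, hP]
    exact hv
  | succ n ih =>
    refine level_succ_le (W := (O.level vac (n + 1)).comap O.P)
      (fun v hv => level_mono n.le_succ (ih v hv)) fun I c v hv => ?_
    rw [Submodule.mem_comap, O.P_α]
    exact Submodule.smul_mem _ _ (α_mem_level I c (ih v hv))

end

/-- The oscillators in which creation and annihilation are exchanged for the columns of the
second kind. -/
def mixed (O : Oscillators p q (Bool × C) F) : Oscillators p q (Bool × C) F where
  P := O.P
  α I c := if c.1 then O.β I c else O.α I c
  -- Exchanging the roles preserves the canonical relation for fermions and reverses its sign for
  -- bosons. The factor corrects this, because `superSign I * oscSign I I = -1`.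
  β I c := if c.1 then superSign I • O.α I c else O.β I c
  P_P := O.P_P
  P_α I c v := by split_ifs <;> [exact O.P_β I c v; exact O.P_α I c v]
  P_β I c v := by
    split_ifs
    · simp only [LinearMap.smul_apply, map_smul, O.P_α]
      rw [smul_comm]
    · exact O.P_β I c v
  α_α := by
    rintro I ⟨c, c'⟩ K ⟨d, d'⟩ v
    cases c <;> cases d <;> simp only [if_true, Bool.false_eq_true, if_false]
    · exact O.α_α _ _ _ _ _
    · rw [O.β_α, smul_add, smul_smul, oscSign_comm K, oscSign_mul_self]; simp
    · rw [O.β_α]; simp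
    · exact O.β_β _ _ _ _ _
  β_β := by
    rintro I ⟨c, c'⟩ K ⟨d, d'⟩ v
    cases c <;> cases d <;> simp only [if_true, Bool.false_eq_true, if_false,
      LinearMap.smul_apply, map_smul]
    · exact O.β_β _ _ _ _ _
    · rw [O.β_α, smul_comm]; simp
    · rw [O.β_α, smul_comm (oscSign I K), smul_add, smul_smul (oscSign I K), oscSign_comm K,
        oscSign_mul_self]; simp
    · rw [O.α_α]; simp only [smul_smul]; congr 1; ring
  β_α := by
    rintro I ⟨c, c'⟩ K ⟨d, d'⟩ v
    cases c <;> cases d <;> simp only [if_true, Bool.false_eq_true, if_false,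
      LinearMap.smul_apply, map_smul]
    · exact O.β_α _ _ _ _ _
    · rw [O.β_β]; simp
    · rw [O.α_α, smul_comm]; simp
    · rw [O.β_α]
      by_cases h : I = K ∧ ((true, c') : Bool × C) = (true, d')
      · obtain ⟨rfl, h⟩ := h
        cases h
        simp only [true_and, if_true, smul_add, smul_smul]
        rcases I with i | i <;> simp
      · rw [if_neg h, if_neg (fun h' => h ⟨h'.1.symm, h'.2.symm⟩), zero_add, zero_add,
          smul_comm (superSign I), smul_smul (oscSign I K), oscSign_comm K, oscSign_mul_self, one_smul]

section

variable [Fintype C] {O : Oscillators p q (Bool × C) F} {vac : F}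

theorem bilinear_mixed_apply (O : Oscillators p q (Bool × C) F) (I J : Idx p q) (v : F) :
    O.mixed.bilinear I J v = ∑ c, O.α I (false, c) (O.β J (false, c) v) +
      ∑ c, O.β I (true, c) (superSign J • O.α J (true, c) v) := by
  rw [bilinear_apply, Fintype.sum_prod_type, Fintype.sum_bool, add_comm]
  rfl

/-- In either kind of column an operator pairs one creation with one annihilation, so the number of
particles does not grow. -/
theorem mixed_stable (hvac : ∀ I c, O.β I c vac = 0) (hP : O.P vac = vac) (n : ℕ) :
    O.mixed.toParityRep.Stable (O.level vac n) := by
  refine ⟨P_mem_level hP n, fun I J v hv => ?_⟩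
  change O.mixed.bilinear I J v ∈ _
  rw [bilinear_mixed_apply]
  refine Submodule.add_mem _ (Submodule.sum_mem _ fun c _ => ?_) (Submodule.sum_mem _ fun c _ => ?_)
  · exact α_β_mem_level hvac I J _ _ hv
  · rw [map_smul]
    exact Submodule.smul_mem _ _ (β_mem_level hvac I _ n _ (α_mem_level J _ hv))

end

end Oscillators

/-- Twisting a representation by a multiple of the supertrace. -/
def ParityRep.shift {V : Type*} [AddCommGroup V] [Module ℂ V] (ρ : ParityRep p q V) (t : ℂ) :
    ParityRep p q V where
  P := ρ.P
  e I J := ρ.e I J - (if I = J then t * superSign I else 0) • LinearMap.id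
  P_P := ρ.P_P
  P_e I J v := by
    by_cases h : I = J
    · subst h
      simp [ρ.P_e, sign_add_self]
    · simp [h, ρ.P_e]
  e_e I J K L v := by
    set g := sign (parity I + parity J) (parity K + parity L) with hg
    have hIJ : g * (if I = J then t * superSign I else 0) =
        if I = J then t * superSign I else 0 := by
      split_ifs with h
      · rw [hg, h, sign_add_self, one_mul]
      · rw [mul_zero]
    have hKL : g * (if K = L then t * superSign K else 0) =
        if K = L then t * superSign K else 0 := by
      split_ifs with h
      · rw [hg, h, sign_comm, sign_add_self, one_mul]
      · rw [mul_zero]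
    -- The supertrace vanishes on superbrackets: the two contributions can be nonzero only for `J =
    -- K` and `L = I`, where the Koszul sign matches them.
    have hJK : (if J = K then (if I = L then t * superSign I else 0) else 0) =
        g * (if L = I then (if K = J then t * superSign K else 0) else 0) := by
      by_cases h1 : J = K
      · by_cases h2 : L = I
        · subst h1 h2
          rw [hg, sign_parity_add]
          rcases L with i | i <;> rcases J with j | j <;> simp
        · simp [h2, Ne.symm h2]
      · simp [h1, Ne.symm h1]
    have hif : ∀ (a : Prop) [Decidable a] (x : V) (c : ℂ), (if a then x - c • v else 0) =
        (if a then x else 0) - (if a then c else 0) • v := by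
      intro a _ x c
      split_ifs <;> simp
    simp only [LinearMap.sub_apply, LinearMap.smul_apply, LinearMap.id_apply, map_sub, map_smul,
      hif, smul_sub]
    rw [ρ.e_e I J K L v, ← hg, hJK]
    generalize (if I = J then t * superSign I else 0) = a at *
    generalize (if K = L then t * superSign K else 0) = b at *
    linear_combination (norm := module) hIJ • ρ.e K L v + hKL • ρ.e I J v - (a * hKL) • v

/-! ### The Fock space -/

section Fock

variable (p q : ℕ) (C : Type)

/-- The exterior algebra generated by the fermions. -/
abbrev FermionSpace : Type := ExteriorAlgebra ℂ ((Fin p ⊕ Fin p) × C → ℂ)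

/-- The polynomial algebra generated by the bosons. -/
abbrev BosonSpace : Type := MvPolynomial ((Fin q ⊕ Fin q) × C) ℂ

/-- The Fock space. -/
abbrev Fock : Type := FermionSpace p C ⊗[ℂ] BosonSpace q C

variable {p q C}

/-- Fermionic creation. -/
noncomputable def fermionCreate [DecidableEq C] (k : (Fin p ⊕ Fin p) × C) : Module.End ℂ (FermionSpace p C) :=
  LinearMap.mulLeft ℂ (ExteriorAlgebra.ι ℂ (Pi.single k 1))

/-- Fermionic annihilation. -/
noncomputable def fermionAnnihilate (k : (Fin p ⊕ Fin p) × C) : Module.End ℂ (FermionSpace p C) :=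
  CliffordAlgebra.contractLeft (LinearMap.proj k)

/-- Fermion parity. -/
noncomputable def fermionParity : Module.End ℂ (FermionSpace p C) :=
  (CliffordAlgebra.involute (Q := (0 : QuadraticForm ℂ ((Fin p ⊕ Fin p) × C → ℂ)))).toLinearMap

theorem fermionParity_fermionParity (a : FermionSpace p C) :
    fermionParity (fermionParity a) = a :=
  CliffordAlgebra.involute_involute a

theorem fermionParity_create [DecidableEq C] (k : (Fin p ⊕ Fin p) × C) (a : FermionSpace p C) :
    fermionParity (fermionCreate k a) = -fermionCreate k (fermionParity a) := by
  simp only [fermionParity, fermionCreate, LinearMap.mulLeft_apply, AlgHom.toLinearMap_apply,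
    map_mul]
  rw [ExteriorAlgebra.ι, CliffordAlgebra.involute_ι, neg_mul]

theorem create_create [DecidableEq C] (k l : (Fin p ⊕ Fin p) × C) (a : FermionSpace p C) :
    fermionCreate k (fermionCreate l a) = -fermionCreate l (fermionCreate k a) := by
  have h := ExteriorAlgebra.ι_add_mul_swap (R := ℂ) (Pi.single k 1 : (Fin p ⊕ Fin p) × C → ℂ)
    (Pi.single l 1)
  simp only [fermionCreate, LinearMap.mulLeft_apply, ← mul_assoc]
  rw [← neg_mul, eq_neg_of_add_eq_zero_left h]

theorem annihilate_annihilate (k l : (Fin p ⊕ Fin p) × C) (a : FermionSpace p C) :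
    fermionAnnihilate k (fermionAnnihilate l a) = -fermionAnnihilate l (fermionAnnihilate k a) :=
  CliffordAlgebra.contractLeft_comm _ _ _

theorem annihilate_create [DecidableEq C] (k l : (Fin p ⊕ Fin p) × C) (a : FermionSpace p C) :
    fermionAnnihilate k (fermionCreate l a) =
      (if k = l then a else 0) - fermionCreate l (fermionAnnihilate k a) := by
  simp only [fermionAnnihilate, fermionCreate, LinearMap.mulLeft_apply, ExteriorAlgebra.ι]
  rw [CliffordAlgebra.contractLeft_ι_mul]
  simp [Pi.single_apply]

theorem fermionParity_annihilate (k : (Fin p ⊕ Fin p) × C) (a : FermionSpace p C) :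
    fermionParity (fermionAnnihilate k a) = -fermionAnnihilate k (fermionParity a) := by
  induction a using CliffordAlgebra.left_induction with
  | algebraMap r =>
    simp only [fermionParity, fermionAnnihilate, AlgHom.toLinearMap_apply, AlgHom.commutes]
    rw [CliffordAlgebra.contractLeft_algebraMap, map_zero, neg_zero]
  | add x y hx hy => simp only [map_add, hx, hy, neg_add]
  | ι_mul x m hx =>
    simp only [fermionParity, fermionAnnihilate, AlgHom.toLinearMap_apply] at hx ⊢
    simp only [CliffordAlgebra.contractLeft_ι_mul, map_sub, map_mul, map_smul, hx,
      CliffordAlgebra.involute_ι, neg_mul, map_neg]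
    simp

/-- Creation operators on the Fock space. -/
noncomputable def create [DecidableEq C] : Idx p q → C → Module.End ℂ (Fock p q C)
  | Sum.inl i, c => (fermionCreate (i, c)).rTensor _
  | Sum.inr j, c => (LinearMap.mulLeft ℂ (MvPolynomial.X (j, c))).lTensor _

/-- Annihilation operators on the Fock space. -/
noncomputable def annihilate : Idx p q → C → Module.End ℂ (Fock p q C)
  | Sum.inl i, c => (fermionAnnihilate (i, c)).rTensor _
  | Sum.inr j, c => (MvPolynomial.pderiv (j, c)).toLinearMap.lTensor _

@[simp] theorem create_inl_tmul [DecidableEq C] (i : Fin p ⊕ Fin p) (c : C) (a : FermionSpace p C)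
    (r : BosonSpace q C) :
    create (Sum.inl i) c (a ⊗ₜ[ℂ] r) = fermionCreate (i, c) a ⊗ₜ r := rfl

@[simp] theorem create_inr_tmul [DecidableEq C] (j : Fin q ⊕ Fin q) (c : C) (a : FermionSpace p C)
    (r : BosonSpace q C) :
    create (Sum.inr j) c (a ⊗ₜ[ℂ] r) = a ⊗ₜ (MvPolynomial.X (j, c) * r) := rfl

@[simp] theorem annihilate_inl_tmul (i : Fin p ⊕ Fin p) (c : C) (a : FermionSpace p C)
    (r : BosonSpace q C) :
    annihilate (Sum.inl i) c (a ⊗ₜ[ℂ] r) = fermionAnnihilate (i, c) a ⊗ₜ r := rfl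

@[simp] theorem annihilate_inr_tmul (j : Fin q ⊕ Fin q) (c : C) (a : FermionSpace p C)
    (r : BosonSpace q C) :
    annihilate (Sum.inr j) c (a ⊗ₜ[ℂ] r) = a ⊗ₜ (MvPolynomial.pderiv (j, c) r) := rfl

/-- The commutator of two derivations is a derivation, and this one kills every variable. -/
theorem pderiv_comm {σ : Type} (i j : σ) (r : MvPolynomial σ ℂ) :
    MvPolynomial.pderiv i (MvPolynomial.pderiv j r) =
      MvPolynomial.pderiv j (MvPolynomial.pderiv i r) := by
  classical
  let D (k : σ) : Derivation ℂ (MvPolynomial σ ℂ) (MvPolynomial σ ℂ) := MvPolynomial.pderiv k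
  have : ⁅D i, D j⁆ = 0 := by
    refine MvPolynomial.derivation_ext fun k => ?_
    simp only [D, Derivation.commutator_apply, MvPolynomial.pderiv_X, Derivation.zero_apply]
    rw [Pi.single_apply, Pi.single_apply]
    split_ifs <;> simp
  have h := congrArg (fun E => E r) this
  simpa [D, Derivation.commutator_apply, sub_eq_zero] using h

/-- The oscillators acting on the Fock space. -/
noncomputable def fockOscillators [DecidableEq C] : Oscillators p q C (Fock p q C) where
  P := fermionParity.rTensor _
  α := create
  β := annihilate
  P_P v := by
    induction v using TensorProduct.induction_on with
    | zero => simp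
    | add x y hx hy => simp only [map_add, hx, hy]
    | tmul a r => simp [fermionParity_fermionParity]
  P_α I c v := by
    induction v using TensorProduct.induction_on with
    | zero => simp
    | add x y hx hy => simp only [map_add, hx, hy, smul_add]
    | tmul a r =>
      rcases I with i | j
      · simp [fermionParity_create, parity, sign_one_one, TensorProduct.neg_tmul]
      · simp [parity, show (1 + 1 : ZMod 2) = 0 from rfl, sign_zero_left]
  P_β I c v := by
    induction v using TensorProduct.induction_on with
    | zero => simp
    | add x y hx hy => simp only [map_add, hx, hy, smul_add]
    | tmul a r =>
      rcases I with i | j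
      · simp [fermionParity_annihilate, parity, sign_one_one, TensorProduct.neg_tmul]
      · simp [parity, show (1 + 1 : ZMod 2) = 0 from rfl, sign_zero_left]
  α_α I c K d v := by
    induction v using TensorProduct.induction_on with
    | zero => simp
    | add x y hx hy => simp only [map_add, hx, hy, smul_add]
    | tmul a r =>
      rcases I with i | j <;> rcases K with k | l
      · simp [create_create (i, c), TensorProduct.neg_tmul]
      · simp
      · simp
      · simp [mul_left_comm]
  β_β I c K d v := by
    induction v using TensorProduct.induction_on with
    | zero => simp
    | add x y hx hy => simp only [map_add, hx, hy, smul_add]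
    | tmul a r =>
      rcases I with i | j <;> rcases K with k | l
      · simp [annihilate_annihilate (i, c), TensorProduct.neg_tmul]
      · simp
      · simp
      · simp [pderiv_comm (j, c)]
  β_α I c K d v := by
    induction v using TensorProduct.induction_on with
    | zero => simp
    | add x y hx hy =>
      simp only [map_add, hx, hy, smul_add]
      split_ifs
      · abel
      · simp
    | tmul a r =>
      rcases I with i | j <;> rcases K with k | l
      · simp only [annihilate_inl_tmul, create_inl_tmul, annihilate_create,
          TensorProduct.sub_tmul, Prod.mk.injEq, Sum.inl.injEq, oscSign_inl_inl]
        split_ifs <;> simp [sub_eq_add_neg]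
      · simp
      · simp
      · simp only [annihilate_inr_tmul, create_inr_tmul, Derivation.leibniz,
          MvPolynomial.pderiv_X, Pi.single_apply, Prod.mk.injEq, Sum.inr.injEq,
          oscSign_inr_left, one_smul, smul_eq_mul, TensorProduct.tmul_add, mul_ite, mul_one,
          mul_zero, eq_comm (a := l), eq_comm (a := d)]
        rw [add_comm]
        split_ifs <;> simp

/-- The vacuum. -/
noncomputable def vacuum : Fock p q C := 1 ⊗ₜ 1

theorem annihilate_vacuum (I : Idx p q) (c : C) : annihilate I c (vacuum : Fock p q C) = 0 := by
  rcases I with i | j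
  · simp only [vacuum, annihilate_inl_tmul, fermionAnnihilate]
    rw [CliffordAlgebra.contractLeft_one, TensorProduct.zero_tmul]
  · simp [vacuum]

theorem parity_vacuum [DecidableEq C] : (fockOscillators (p := p) (q := q) (C := C)).P vacuum = vacuum := by
  simp [fockOscillators, vacuum, fermionParity]

theorem exists_mem_level [DecidableEq C] [Fintype C] (v : Fock p q C) :
    ∃ n, v ∈ fockOscillators.level vacuum n := by
  have hadd : ∀ v w : Fock p q C, (∃ n, v ∈ fockOscillators.level vacuum n) →
      (∃ n, w ∈ fockOscillators.level vacuum n) →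
      ∃ n, v + w ∈ fockOscillators.level vacuum n := by
    rintro v w ⟨m, hm⟩ ⟨n, hn⟩
    exact ⟨max m n, Submodule.add_mem _ (Oscillators.level_mono (le_max_left m n) hm)
      (Oscillators.level_mono (le_max_right m n) hn)⟩
  induction v using TensorProduct.induction_on with
  | zero => exact ⟨0, Submodule.zero_mem _⟩
  | add v w hv hw => exact hadd v w hv hw
  | tmul a r =>
    induction a using CliffordAlgebra.left_induction with
    | algebraMap t =>
      induction r using MvPolynomial.induction_on with
      | C u =>
        refine ⟨0, Submodule.mem_span_singleton.2 ⟨t * u, ?_⟩⟩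
        rw [vacuum, ← TensorProduct.smul_tmul_smul, Algebra.algebraMap_eq_smul_one,
          MvPolynomial.C_eq_smul_one]
      | add r r' h h' => rw [TensorProduct.tmul_add]; exact hadd _ _ h h'
      | mul_X r k h =>
        obtain ⟨n, hn⟩ := h
        refine ⟨n + 1, ?_⟩
        rw [mul_comm]
        exact Oscillators.α_mem_level (O := fockOscillators) (Sum.inr k.1) k.2 hn
    | add a b h h' => rw [TensorProduct.add_tmul]; exact hadd _ _ h h'
    | ι_mul a m h =>
      obtain ⟨n, hn⟩ := h
      refine ⟨n + 1, ?_⟩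
      have hm : m = ∑ k, m k • (Pi.single k 1 : (Fin p ⊕ Fin p) × C → ℂ) := by
        simpa using (pi_eq_sum_univ' m)
      have h1 : (ExteriorAlgebra.ι ℂ m * a) ⊗ₜ[ℂ] r =
          ∑ k, m k • (fockOscillators (q := q)).α (Sum.inl k.1) k.2 (a ⊗ₜ r) := by
        conv_lhs => rw [hm]
        simp only [map_sum, map_smul, Finset.sum_mul, smul_mul_assoc, TensorProduct.sum_tmul]
        rfl
      rw [ExteriorAlgebra.ι] at h1
      rw [h1]
      exact Submodule.sum_mem _ fun k _ => Submodule.smul_mem _ _ (Oscillators.α_mem_level _ _ hn)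

/-- Fermionic states with prescribed occupied modes. -/
theorem exists_occupied [DecidableEq C] (S : Finset ((Fin p ⊕ Fin p) × C)) :
    ∃ ξ : FermionSpace p C, ξ ≠ 0 ∧ (∀ k ∈ S, fermionCreate k ξ = 0) ∧
      ∀ k ∉ S, fermionAnnihilate k ξ = 0 := by
  induction S using Finset.induction_on with
  | empty => 
    refine ⟨1, one_ne_zero, by simp, fun k _ => CliffordAlgebra.contractLeft_one _ _⟩
  | insert k S hk ih =>
    obtain ⟨ξ, h0, h1, h2⟩ := ih
    -- Annihilation recovers `ξ`, so the new state is nonzero.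
    have h3 : fermionAnnihilate k (fermionCreate k ξ) = ξ := by
      rw [annihilate_create, h2 k hk, if_pos rfl, map_zero, sub_zero]
    refine ⟨fermionCreate k ξ, fun h => h0 (by rw [← h3, h, map_zero]), fun l hl => ?_,
      fun l hl => ?_⟩
    · rcases Finset.mem_insert.1 hl with rfl | hl
      · exact eq_zero_of_eq_neg (create_create l l ξ)
      · rw [create_create, h1 l hl, map_zero, neg_zero]
    · rw [Finset.mem_insert, not_or] at hl
      rw [annihilate_create, h2 l hl.2, if_neg hl.1, map_zero, sub_zero]

end Fock

/-! ### Derivations of determinants and monomials -/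

section Derivation

variable {R : Type*} [CommRing R] [Algebra ℂ R]

theorem derivation_prod {ι : Type*} [DecidableEq ι] (D : Derivation ℂ R R) (s : Finset ι)
    (f : ι → R) : D (∏ a ∈ s, f a) = ∑ a ∈ s, (∏ b ∈ s.erase a, f b) * D (f a) := by
  induction s using Finset.induction_on with
  | empty => simp
  | insert a s ha ih =>
    rw [Finset.prod_insert ha, D.leibniz, ih, Finset.sum_insert ha, Finset.erase_insert ha, add_comm,
      smul_eq_mul, smul_eq_mul, Finset.mul_sum]
    congr 1
    refine Finset.sum_congr rfl fun b hb => ?_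
    have hab : a ≠ b := fun h => ha (h ▸ hb)
    rw [Finset.erase_insert_of_ne hab, Finset.prod_insert (by simp [ha]), mul_assoc]

/-- The product rule in each term of the permutation expansion, regrouped by the column that is
differentiated. -/
theorem derivation_det {n : Type*} [DecidableEq n] [Fintype n] (D : Derivation ℂ R R)
    (M : Matrix n n R) : D M.det = ∑ j, (M.updateCol j fun i => D (M i j)).det := by
  simp only [Matrix.det_apply, map_sum, Units.smul_def, map_zsmul]
  rw [Finset.sum_comm]
  refine Finset.sum_congr rfl fun σ _ => ?_
  rw [derivation_prod, Finset.smul_sum]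
  refine Finset.sum_congr rfl fun j _ => ?_
  congr 1
  rw [← Finset.prod_erase_mul _ _ (Finset.mem_univ j)]
  congr 1
  · refine Finset.prod_congr rfl fun i hi => ?_
    rw [Matrix.updateCol_ne (Finset.ne_of_mem_erase hi)]
  · rw [Matrix.updateCol_self]

theorem derivation_det_eq_zero {n : Type*} [DecidableEq n] [Fintype n] (D : Derivation ℂ R R)
    (M : Matrix n n R) (h : ∀ i j, D (M i j) = 0) : D M.det = 0 := by
  rw [derivation_det]
  refine Finset.sum_eq_zero fun j _ => Matrix.det_eq_zero_of_column_eq_zero j fun i => ?_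
  rw [Matrix.updateCol_self, h]

/-- Such a derivation replaces column `b` by column `a`, which produces a repeated column unless `a
= b`. -/
theorem derivation_det_of_column {n : Type*} [DecidableEq n] [Fintype n] (D : Derivation ℂ R R)
    (M : Matrix n n R) (a b : n) (h : ∀ i j, D (M i j) = if j = b then M i a else 0) :
    D M.det = if a = b then M.det else 0 := by
  rw [derivation_det, Finset.sum_eq_single b]
  · split_ifs with hab
    · congr 1
      ext i j
      rw [Matrix.updateCol_apply]
      split_ifs with hj
      · rw [h, if_pos rfl, hab, hj]
      · rfl
    · refine Matrix.det_zero_of_column_eq hab fun i => ?_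
      rw [Matrix.updateCol_ne hab, Matrix.updateCol_self, h, if_pos rfl]
  · intro j _ hj
    refine Matrix.det_eq_zero_of_column_eq_zero j fun i => ?_
    rw [Matrix.updateCol_self, h, if_neg hj]
  · simp

/-- Logarithmic differentiation: eigenvalues add with multiplicity, and factors with exponent zero
are unconstrained. -/
theorem derivation_prod_pow {ι : Type*} [DecidableEq ι] (D : Derivation ℂ R R) (s : Finset ι)
    (g : ι → R) (n : ι → ℕ) (c : ι → ℂ) (h : ∀ x ∈ s, n x = 0 ∨ D (g x) = c x • g x) :
    D (∏ x ∈ s, g x ^ n x) = (∑ x ∈ s, n x * c x) • ∏ x ∈ s, g x ^ n x := by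
  have hp : ∀ x ∈ s, D (g x ^ n x) = (n x * c x) • g x ^ n x := by
    intro x hx
    rcases h x hx with h0 | h1
    · simp [h0]
    · cases hn : n x with
      | zero => simp
      | succ m =>
        rw [D.leibniz_pow, h1, Nat.add_sub_cancel, smul_eq_mul, mul_smul_comm, ← pow_succ, mul_smul,
          Nat.cast_smul_eq_nsmul]
  rw [derivation_prod, Finset.sum_smul]
  refine Finset.sum_congr rfl fun x hx => ?_
  rw [hp x hx, mul_smul_comm, Finset.prod_erase_mul _ _ hx]

end Derivation

/-! ### The highest weight vector -/

section Vector

variable {s : ℕ}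

/-- The sign (`true` for `+`) of a coordinate. -/
def side {n : ℕ} : Fin n ⊕ Fin n → Bool := Sum.elim (fun _ => true) fun _ => false

/-- The number of a coordinate. -/
def row {n : ℕ} : Fin n ⊕ Fin n → Fin n := Sum.elim id id

/-- The coordinate with given sign and number. -/
def coord {n : ℕ} (σ : Bool) (j : Fin n) : Fin n ⊕ Fin n := if σ then Sum.inl j else Sum.inr j

@[simp] theorem side_coord {n : ℕ} (σ : Bool) (j : Fin n) : side (coord σ j) = σ := by
  cases σ <;> rfl

@[simp] theorem row_coord {n : ℕ} (σ : Bool) (j : Fin n) : row (coord σ j) = j := by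
  cases σ <;> rfl

@[simp] theorem coord_side_row {n : ℕ} (x : Fin n ⊕ Fin n) : coord (side x) (row x) = x := by
  rcases x with j | j <;> rfl

theorem coord_inj {n : ℕ} {σ τ : Bool} {i j : Fin n} :
    coord σ i = coord τ j ↔ σ = τ ∧ i = j :=
  ⟨fun h => ⟨by simpa using congrArg side h, by simpa using congrArg row h⟩, by
    rintro ⟨rfl, rfl⟩; rfl⟩

/-- The minor of order `k + 1` of the matrix of bosons, padded by the identity matrix. -/
noncomputable def minor (hqs : q ≤ s) (σ : Bool) (k : Fin q) :
    Matrix (Fin q) (Fin q) (BosonSpace q (Bool × Fin s)) :=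
  fun b j => if b ≤ k ∧ j ≤ k then MvPolynomial.X (coord σ j, (σ, b.castLE hqs))
    else if b = j then 1 else 0

/-- A product of powers of minors. -/
noncomputable def minorProduct (hqs : q ≤ s) (m : Fin q → ℕ) : BosonSpace q (Bool × Fin s) :=
  ∏ x : Bool × Fin q, (minor hqs x.1 x.2).det ^ m x.2

/-- At the point where a boson is 1 if its coordinate and column have the same number and 0
otherwise, every padded minor becomes the identity matrix. -/
theorem minorProduct_ne_zero (hqs : q ≤ s) (m : Fin q → ℕ) : minorProduct hqs m ≠ 0 := by
  let pt : (Fin q ⊕ Fin q) × (Bool × Fin s) → ℂ :=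
    fun y => if (row y.1 : ℕ) = y.2.2 then 1 else 0
  have h : MvPolynomial.eval pt (minorProduct hqs m) = 1 := by
    rw [minorProduct, map_prod]
    refine Finset.prod_eq_one fun x _ => ?_
    have : (MvPolynomial.eval pt).mapMatrix (minor hqs x.1 x.2) = 1 := by
      ext b j
      rw [RingHom.mapMatrix_apply, Matrix.map_apply, minor, Matrix.one_apply]
      by_cases h1 : b = j
      · subst h1
        rw [if_pos rfl, if_pos rfl]
        split_ifs <;> simp [pt]
      · have : (j : ℕ) ≠ b := fun h => h1 (Fin.ext h.symm)
        split_ifs <;> simp [pt, this]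
    rw [map_pow, RingHom.map_det, this, Matrix.det_one, one_pow]
  intro h0
  rw [h0, map_zero] at h
  exact zero_ne_one h

theorem pderiv_minorProduct (hqs : q ≤ s) (m : Fin q → ℕ) (y : (Fin q ⊕ Fin q) × (Bool × Fin s))
    (h : ∀ k, m k ≠ 0 → side y.1 = y.2.1 → ¬(y.2.2 : ℕ) ≤ k) :
    MvPolynomial.pderiv y (minorProduct hqs m) = 0 := by
  refine (derivation_prod_pow (MvPolynomial.pderiv y) Finset.univ
    (fun x : Bool × Fin q => (minor hqs x.1 x.2).det) (fun x => m x.2) 0 ?_).trans (by simp)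
  rintro ⟨σ, k⟩ -
  by_cases hm : m k = 0
  · exact .inl hm
  refine .inr ?_
  rw [Pi.zero_apply, zero_smul]
  refine derivation_det_eq_zero _ _ fun b j => ?_
  dsimp only [minor]
  split_ifs with h1
  · rw [MvPolynomial.pderiv_X_of_ne]
    rintro rfl
    exact h k hm (by simp) h1.1
  · exact Derivation.map_one_eq_zero _
  · exact map_zero _

/-- The polarization operators. -/
noncomputable def polarization (s : ℕ) (σ : Bool) (i j : Fin q) :
    Derivation ℂ (BosonSpace q (Bool × Fin s)) (BosonSpace q (Bool × Fin s)) :=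
  ∑ b : Fin s, (MvPolynomial.X (coord σ i, (σ, b)) : BosonSpace q (Bool × Fin s)) •
    MvPolynomial.pderiv (coord σ j, (σ, b))

theorem polarization_apply (σ : Bool) (i j : Fin q) (f : BosonSpace q (Bool × Fin s)) :
    polarization s σ i j f = ∑ b : Fin s, MvPolynomial.X (coord σ i, (σ, b)) *
      MvPolynomial.pderiv (coord σ j, (σ, b)) f := by
  have := congrFun (map_sum (Derivation.coeFnAddMonoidHom (R := ℂ)) (fun b : Fin s =>
    (MvPolynomial.X (coord σ i, (σ, b)) : BosonSpace q (Bool × Fin s)) •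
      (MvPolynomial.pderiv (coord σ j, (σ, b)) : Derivation ℂ (BosonSpace q (Bool × Fin s)) _))
    Finset.univ) f
  rw [Finset.sum_apply] at this
  exact this

theorem polarization_X (σ τ : Bool) (i j l : Fin q) (b : Fin s) :
    polarization s σ i j (MvPolynomial.X (coord τ l, (τ, b))) =
      if τ = σ ∧ l = j then MvPolynomial.X (coord σ i, (σ, b)) else 0 := by
  rw [polarization_apply, Finset.sum_eq_single b]
  · rw [MvPolynomial.pderiv_X, Pi.single_apply]
    by_cases h : τ = σ ∧ l = j
    · rw [if_pos h, if_pos (by rw [h.1, h.2]), mul_one]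
    · rw [if_neg h, if_neg, mul_zero]
      intro h'
      exact h (coord_inj.1 (congrArg Prod.fst h'))
  · intro c _ hc
    rw [MvPolynomial.pderiv_X_of_ne, mul_zero]
    intro h'
    exact hc (congrArg (fun y => y.2.2) h').symm
  · simp

/-- The operator substitutes column `i` for column `j`. Since `i ≤ j`, both columns lie in the minor
as soon as `j` does, so the result has a repeated column unless `i = j`. -/
theorem polarization_minor (hqs : q ≤ s) (σ τ : Bool) (k i j : Fin q) (hij : i ≤ j) :
    polarization s σ i j (minor hqs τ k).det =
      (if τ = σ ∧ i = j ∧ j ≤ k then (1 : ℂ) else 0) • (minor hqs τ k).det := by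
  by_cases h : τ = σ ∧ j ≤ k
  · obtain ⟨rfl, hjk⟩ := h
    rw [derivation_det_of_column _ _ i j]
    · by_cases h : i = j <;> simp [h, hjk]
    · intro b l
      dsimp only [minor]
      by_cases h1 : b ≤ k ∧ l ≤ k
      · rw [if_pos h1, polarization_X, if_pos (c := b ≤ k ∧ i ≤ k) ⟨h1.1, hij.trans hjk⟩]
        simp only [true_and]
      · rw [if_neg h1]
        have h2 : polarization s τ i j
            (if b = l then 1 else 0 : BosonSpace q (Bool × Fin s)) = 0 := by
          split_ifs
          · exact Derivation.map_one_eq_zero _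
          · exact map_zero _
        rw [h2]
        split_ifs with h3 h4 h5
        · exact absurd ⟨h4.1, h3 ▸ hjk⟩ h1
        · exact absurd ⟨h5 ▸ hij.trans hjk, h3 ▸ hjk⟩ h1
        · rfl
        · rfl
  · rw [derivation_det_eq_zero]
    · rw [if_neg (fun h' => h ⟨h'.1, h'.2.2⟩), zero_smul]
    · intro b l
      dsimp only [minor]
      split_ifs with h1
      · rw [polarization_X, if_neg]
        rintro ⟨rfl, rfl⟩
        exact h ⟨rfl, h1.2⟩
      · exact Derivation.map_one_eq_zero _
      · exact map_zero _

theorem polarization_minorProduct (hqs : q ≤ s) (m : Fin q → ℕ) (σ : Bool) {i j : Fin q}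
    (hij : i ≤ j) : polarization s σ i j (minorProduct hqs m) =
      (if i = j then ((∑ k with j ≤ k, m k : ℕ) : ℂ) else 0) • minorProduct hqs m := by
  refine (derivation_prod_pow (polarization s σ i j) Finset.univ
    (fun x : Bool × Fin q => (minor hqs x.1 x.2).det) (fun x => m x.2)
    (fun x => if x.1 = σ ∧ i = j ∧ j ≤ x.2 then (1 : ℂ) else 0)
    fun x _ => .inr (polarization_minor hqs σ x.1 x.2 i j hij)).trans ?_
  rw [minorProduct]
  congr 1
  rw [Fintype.sum_prod_type, Finset.sum_eq_single σ]
  · by_cases h : i = j <;> simp [h, Finset.sum_filter]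
  · intro τ _ hτ
    simp [hτ]
  · simp

/-- The sign of a coordinate of `ℂ^{2p|2q}`. -/
def sideIdx : Idx p q → Bool := Sum.elim side side

/-- The place of a coordinate among the coordinates of the same sign. -/
def rank : Idx p q → ℕ := Sum.elim (fun x => row x) fun x => p + row x

/-- Minus coordinates precede plus coordinates; ranks increase along the former and decrease along
the latter. The reversal matches the dual action in columns of the second kind. -/
theorem position_lt {I J : Idx p q} (h : position I < position J) :
    (sideIdx I = false ∧ sideIdx J = true) ∨
    (sideIdx I = false ∧ sideIdx J = false ∧ rank I < rank J) ∨
    (sideIdx I = true ∧ sideIdx J = true ∧ rank J < rank I) := by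
  rcases I with (i | i) | (i | i) <;> rcases J with (j | j) | (j | j) <;>
    simp only [position, Fin.val_rev] at h <;>
    simp only [sideIdx, rank, side, row, Sum.elim_inl, Sum.elim_inr, id, true_and, and_self,
      Bool.false_eq_true, reduceCtorEq, false_and, or_false, false_or] <;> omega

/-- The coefficients of `λ^♮`. -/
def naturalWeight (lam : YoungDiagram) : Idx p q → ℕ :=
  Sum.elim (fun x => lam.rowLen (row x)) fun x => lam.colLen (row x) - p

theorem negNaturalWeight_eq (lam : YoungDiagram) (I : Idx p q) : negNaturalWeight p q lam I =
    if sideIdx I then -(naturalWeight lam I : ℂ) else naturalWeight lam I := by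
  rcases I with (i | i) | (i | i) <;> simp [negNaturalWeight, sideIdx, side, naturalWeight, row]

theorem tmul_ne_zero {V W : Type*} [AddCommGroup V] [Module ℂ V] [AddCommGroup W] [Module ℂ W]
    {v : V} {w : W} (hv : v ≠ 0) (hw : w ≠ 0) : v ⊗ₜ[ℂ] w ≠ 0 := by
  intro h
  obtain ⟨f, hf⟩ := Module.Projective.exists_dual_eq_one ℂ hv
  have := congrArg (TensorProduct.lid ℂ W) (congrArg (f.rTensor W) h)
  rw [LinearMap.rTensor_tmul, TensorProduct.lid_tmul, hf, one_smul, map_zero, map_zero] at this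
  exact hw this

/-- A highest weight vector for the two bilinear actions on the Fock space. -/
theorem exists_fock_vector (lam : YoungDiagram) (hlam : IsHookPartition p q lam) (hqs : q ≤ s)
    (hs : lam.rowLen 0 ≤ s) : ∃ w : Fock p q (Bool × Fin s), w ≠ 0 ∧
      (∀ I c, sideIdx I ≠ c.1 → annihilate I c w = 0) ∧
      ∀ I J σ, sideIdx I = σ → sideIdx J = σ → rank I < rank J ∨ I = J →
        ∑ b, create I (σ, b) (annihilate J (σ, b) w) =
          (if I = J then (naturalWeight lam I : ℂ) else 0) • w := by
  -- Occupied modes are the boxes in the first `p` rows of the diagram, one copy for each sign.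
  let S : Finset ((Fin p ⊕ Fin p) × (Bool × Fin s)) :=
    Finset.univ.filter fun k => side k.1 = k.2.1 ∧ (k.2.2 : ℕ) < lam.rowLen (row k.1)
  have hS : ∀ k, k ∈ S ↔ side k.1 = k.2.1 ∧ (k.2.2 : ℕ) < lam.rowLen (row k.1) := by simp [S]
  obtain ⟨ξ, hξ0, hξS, hξ⟩ := exists_occupied S
  let ν : ℕ → ℕ := fun j => lam.colLen j - p
  have hν : Antitone ν := fun i j hij => Nat.sub_le_sub_right (lam.colLen_anti i j hij) p
  -- A column reaching below row `p` meets every row numbered up to `p`, counted from 0. At `i = p`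
  -- this turns the hook condition into `ν q = 0`; for `i < p` it makes the mixed root vectors
  -- vanish.
  have hνpos : ∀ k i : ℕ, 0 < ν k → i ≤ p → k < lam.rowLen i := by
    intro k i hk hi
    rw [← YoungDiagram.mem_iff_lt_rowLen, YoungDiagram.mem_iff_lt_colLen]
    have : 0 < lam.colLen k - p := hk
    omega
  have hνq : ν q = 0 := by
    by_contra h
    exact absurd (hνpos q p (Nat.pos_of_ne_zero h) le_rfl) (not_lt.2 hlam)
  -- With these exponents the number of minors involving coordinate `j` telescopes to `ν j`.
  let m : Fin q → ℕ := fun k => ν k - ν (k + 1)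
  have hm : ∀ k, m k ≠ 0 → 0 < ν k := by
    intro k hk
    have : ν k - ν (k + 1) ≠ 0 := hk
    omega
  have hmsum : ∀ j : Fin q, ∑ k with j ≤ k, m k = ν j := by
    intro j
    have h1 : ∀ d : ℕ, ∑ k ∈ Finset.Ico (j : ℕ) (j + d), (ν k - ν (k + 1)) = ν j - ν (j + d) := by
      intro d
      induction d with
      | zero => simp
      | succ d ih =>
        rw [← add_assoc, Finset.sum_Ico_succ_top (by omega), ih]
        have h2 := hν (show (j : ℕ) ≤ j + d by omega)
        have h3 := hν (show (j : ℕ) + d ≤ j + d + 1 by omega)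
        omega
    have h2 := h1 (q - j)
    rw [show (j : ℕ) + (q - j) = q by omega, hνq, Nat.sub_zero] at h2
    rw [← h2, Finset.sum_filter]
    refine (Fin.sum_univ_eq_sum_range (fun k : ℕ => if (j : ℕ) ≤ k then ν k - ν (k + 1) else 0)
      q).trans ?_
    rw [← Finset.sum_filter]
    congr 1
    ext k
    simp [and_comm]
  let f := minorProduct hqs m
  refine ⟨ξ ⊗ₜ f, ?_, ?_, ?_⟩
  · exact tmul_ne_zero hξ0 (minorProduct_ne_zero hqs m)
  · rintro (x | y) ⟨σ, b⟩ h
    · rw [annihilate_inl_tmul, hξ, TensorProduct.zero_tmul]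
      rw [hS]
      exact fun h' => h h'.1
    · rw [annihilate_inr_tmul, pderiv_minorProduct, TensorProduct.tmul_zero]
      exact fun k _ h' => absurd h' h
  · rintro (x | x) (y | y) σ hx hy hr
    · simp only [annihilate_inl_tmul, create_inl_tmul, ← TensorProduct.sum_tmul]
      rw [TensorProduct.smul_tmul']
      congr 1
      by_cases hxy : x = y
      · subst hxy
        have hb : ∀ b : Fin s, fermionCreate (x, (σ, b)) (fermionAnnihilate (x, (σ, b)) ξ) =
            if (b : ℕ) < lam.rowLen (row x) then ξ else 0 := by
          intro b
          split_ifs with h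
          · have h1 := annihilate_create (x, (σ, b)) (x, (σ, b)) ξ
            rw [hξS _ ((hS (x, (σ, b))).2 ⟨hx, h⟩), map_zero, if_pos rfl] at h1
            exact (sub_eq_zero.1 h1.symm).symm
          · rw [hξ _ (fun h' => h ((hS (x, (σ, b))).1 h').2), map_zero]
        have hle : lam.rowLen (row x) ≤ s := (lam.rowLen_anti 0 _ (Nat.zero_le _)).trans hs
        simp only [hb]
        rw [← Finset.sum_filter, Finset.sum_const, Fin.card_filter_val_lt, min_eq_right hle,
          if_pos trivial, ← Nat.cast_smul_eq_nsmul ℂ]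
        rfl
      · have hne : (Sum.inl x : Idx p q) ≠ Sum.inl y := fun h => hxy (Sum.inl.inj h)
        have hlt : (row x : ℕ) < row y := hr.resolve_right hne
        rw [if_neg hne, zero_smul]
        refine Finset.sum_eq_zero fun b _ => ?_
        -- If the mode of `y` is occupied, so is that of `x`, whose row is at least as long;
        -- creation then gives zero.
        by_cases h : (b : ℕ) < lam.rowLen (row y)
        · have h1 := annihilate_create (y, (σ, b)) (x, (σ, b)) ξ
          rw [hξS _ ((hS (x, (σ, b))).2 ⟨hx, h.trans_le (lam.rowLen_anti _ _ hlt.le)⟩), map_zero,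
            if_neg (fun h' => hxy (congrArg Prod.fst h').symm), zero_sub] at h1
          exact neg_eq_zero.1 h1.symm
        · rw [hξ _ (fun h' => h ((hS (y, (σ, b))).1 h').2), map_zero]
    · rw [if_neg (by simp), zero_smul]
      refine Finset.sum_eq_zero fun b _ => ?_
      rw [annihilate_inr_tmul, create_inl_tmul]
      -- Bosons occur only in columns `b ≤ k` with `ν k > 0`, where the fermion mode of `x` is
      -- already occupied.
      by_cases hb : (b : ℕ) < lam.rowLen (row x)
      · rw [hξS _ ((hS (x, (σ, b))).2 ⟨hx, hb⟩), TensorProduct.zero_tmul]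
      · rw [pderiv_minorProduct, TensorProduct.tmul_zero]
        intro k hk _ hbk
        have := hνpos k (row x) (hm k hk) (row x).2.le
        simp only at hbk
        omega
    · simp only [rank, Sum.elim_inl, Sum.elim_inr, reduceCtorEq, or_false] at hr
      have := (row y).2
      omega
    · have hxy : row x ≤ row y := by
        rcases hr with hr | hr
        · simp only [rank, Sum.elim_inr] at hr
          rw [Fin.le_def]; omega
        · rw [Sum.inr.inj hr]
      have h := polarization_minorProduct hqs m σ hxy
      rw [polarization_apply] at h
      simp only [sideIdx, Sum.elim_inr] at hx hy
      have hxc : coord σ (row x) = x := by rw [← hx, coord_side_row]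
      have hyc : coord σ (row y) = y := by rw [← hy, coord_side_row]
      rw [hxc, hyc, hmsum] at h
      simp only [annihilate_inr_tmul, create_inr_tmul, ← TensorProduct.tmul_sum]
      rw [h, TensorProduct.tmul_smul]
      congr 1
      have : row x = row y ↔ x = y := ⟨fun h => by rw [← hxc, ← hyc, h], fun h => by rw [h]⟩
      simp only [this, Sum.inr.injEq]
      split_ifs with h
      · rw [h]; rfl
      · rfl

/-- The highest weight vector of weight `-λ^♮` in the Fock representation. -/
theorem fock_isHW {lam : YoungDiagram} {w : Fock p q (Bool × Fin s)}
    (h1 : ∀ I c, sideIdx I ≠ c.1 → annihilate I c w = 0)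
    (h2 : ∀ I J σ, sideIdx I = σ → sideIdx J = σ → rank I < rank J ∨ I = J →
      ∑ b, create I (σ, b) (annihilate J (σ, b) w) =
        (if I = J then (naturalWeight lam I : ℂ) else 0) • w) :
    ((fockOscillators (p := p) (q := q) (C := Bool × Fin s)).mixed.toParityRep.shift s).IsHW
      (negNaturalWeight p q lam) w := by
  -- Normal ordering in the `s` columns of the second kind yields the constant `s * superSign I` for
  -- `I = J`, which the shift removes.
  have he : ∀ I J, ((fockOscillators (p := p) (q := q)
      (C := Bool × Fin s)).mixed.toParityRep.shift s).e I J w =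
      ∑ b, create I (false, b) (annihilate J (false, b) w) +
        (superSign J * oscSign I J) • ∑ b, create J (true, b) (annihilate I (true, b) w) := by
    intro I J
    have : ∀ b : Fin s, annihilate I (true, b) (create J (true, b) w) =
        (if I = J then w else 0) + oscSign I J • create J (true, b) (annihilate I (true, b) w) := by
      intro b
      have := (fockOscillators (p := p) (q := q)).β_α I (true, b) J (true, b) w
      refine Eq.trans this ?_
      simp only [and_true]
      rfl
    change (fockOscillators (p := p) (q := q)).mixed.bilinear I J w -
      (if I = J then (s : ℂ) * superSign I else 0) • w = _
    rw [Oscillators.bilinear_mixed_apply]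
    simp only [map_smul, ← Finset.smul_sum]
    change _ + superSign J • ∑ b, annihilate I (true, b) (create J (true, b) w) - _ = _
    simp only [this, Finset.sum_add_distrib, ← Finset.smul_sum, Finset.sum_const,
      Finset.card_univ, Fintype.card_fin, ← Nat.cast_smul_eq_nsmul ℂ]
    rw [smul_add, smul_smul _ (oscSign I J)]
    change ∑ b, create I (false, b) (annihilate J (false, b) w) + _ - _ = _
    by_cases h : I = J
    · subst h
      simp only [if_true]
      module
    · simp [h]
  have hzero : ∀ I J σ, sideIdx J ≠ σ →
      ∑ b, create I (σ, b) (annihilate J (σ, b) w) = 0 := fun I J σ h =>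
    Finset.sum_eq_zero fun b _ => by rw [h1 J (σ, b) h, map_zero]
  refine ⟨fun I => ?_, fun I J hIJ => ?_⟩
  · rw [he, negNaturalWeight_eq]
    cases hI : sideIdx I
    · rw [hzero I I true (by simp [hI]), h2 I I false hI hI (.inr rfl)]
      simp
    · rw [hzero I I false (by simp [hI]), h2 I I true hI hI (.inr rfl)]
      -- Here `superSign I * oscSign I I = -1` gives the negative weight on plus coordinates.
      rcases I with i | i <;> simp [-neg_smul, smul_smul]
  · have hne : I ≠ J := by rintro rfl; omega
    rw [he]
    rcases position_lt hIJ with ⟨hI, hJ⟩ | ⟨hI, hJ, hr⟩ | ⟨hI, hJ, hr⟩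
    · rw [hzero I J false (by simp [hJ]), hzero J I true (by simp [hI]), smul_zero, add_zero]
    · rw [h2 I J false hI hJ (.inl hr), hzero J I true (by simp [hI]), if_neg hne, zero_smul,
        smul_zero, add_zero]
    · rw [hzero I J false (by simp [hJ]), h2 J I true hJ hI (.inl hr), if_neg hne.symm, zero_smul,
        smul_zero, add_zero]

theorem shift_stable {V : Type*} [AddCommGroup V] [Module ℂ V] {ρ : ParityRep p q V}
    {W : Submodule ℂ V} (h : ρ.Stable W) (t : ℂ) : (ρ.shift t).Stable W :=
  ⟨h.1, fun I J v hv => W.sub_mem (h.2 I J v hv) (W.smul_mem _ hv)⟩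

end Vector

end GLSuper

theorem mainTheorem6 (p q : ℕ) (lam : YoungDiagram)
    (hlam : GLSuper.IsHookPartition p q lam) :
    (∃ (V : Type) (_ : AddCommGroup V) (_ : Module ℂ V) (M : GLSuper.SuperModule p q V),
      M.IsIrreducibleOfHighestWeight (GLSuper.borelNaturalMinus p q)
        (GLSuper.negNaturalWeight p q lam)) ∧
    ∀ (V : Type*) [AddCommGroup V] [Module ℂ V] (M : GLSuper.SuperModule p q V),
      M.IsIrreducibleOfHighestWeight (GLSuper.borelNaturalMinus p q)
        (GLSuper.negNaturalWeight p q lam) →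
      FiniteDimensional ℂ V := by
  -- The number of columns must be at least `q` to accommodate the minors and at least the longest
  -- row to accommodate the fermions.
  obtain ⟨w, hw0, h1, h2⟩ := GLSuper.exists_fock_vector (s := q + lam.rowLen 0) lam hlam
    (Nat.le_add_right _ _) (Nat.le_add_left _ _)
  obtain ⟨n, hn⟩ := GLSuper.exists_mem_level w
  exact GLSuper.exists_irreducible_and_finiteDimensional (GLSuper.fock_isHW h1 h2) hw0
    (GLSuper.shift_stable (GLSuper.Oscillators.mixed_stable GLSuper.annihilate_vacuum
      GLSuper.parity_vacuum n) _) hn
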